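/- For $n\ge 1$ let $Q_n$ be the Hamming cube with vertex set $V=\{0,1\}^n$ (two vertices are adjacent if they differ in exactly one coordinate), and let $\mu$ be the uniform probability measure on $V$. For $A\subseteq V$ let $h_A(x)$ be the number of neighbours of $x$ in $V\setminus A$ if $x\in A$, and $h_A(x)=0$ if $x\notin A$. For $A,B\subseteq V$ let $\nabla(A,B)$ be the set of edges $(x,y)$ of $Q_n$ with $x\in A$, $y\in B$; for $i\in[n]$ let $\nabla_iA=\{(x,x^i):x\in A,\ x^i\notin A\}$, where $x^i$ is $x$ with its $i$-th coordinate flipped. A codimension $k$ subcube is a set $\{x\in V: x_i=z_i\ \forall i\in I\}$ with $I\subseteq[n]$, $|I|=k$, $z\in\{0,1\}^I$. **Theorem 1.10.** Fix an integer $k\ge 1$ and functions $f:[0,\infty)\to[0,\infty)$ and $g:[0,1]\to[0,\infty)$ such that $g$ is continuous with $g(2^{-k})=k2^{-k}$, and $f$ is increasing and strictly concave with $f(0)=0$ and $f(k)=k$. Then there is a constant $K>0$, depending only on $k$, $f$ and $g$, such that the following holds. Let $n\ge k$ be such that $$\int f(h_A)\,d\mu\ \ge\ g(\mu(A))\qquad\text{for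 every } A\subseteq V=\{0,1\}^n ,$$ let $\varepsilon>0$, and let $(A,B,W)$ be a partition of $V$ (parts may be empty) with $$|\mu(A)-2^{-k}|\le \varepsilon 2^{-k},\qquad \mu(W)\le \varepsilon/f(n),\qquad |\nabla(A,B)|<(1+\varepsilon)k2^{n-k}.$$ Then there is $I\subseteq[n]$ with $|I|=k$ such that $$\bigl|\,|\nabla_iA|-2^{n-k}\bigr|\le K\varepsilon 2^{n-k}\qquad\text{for all } i\in I,$$ and there is a codimension $k$ subcube $C$ with $\mu(C\,\Delta\,A)\le K\varepsilon$. -/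

import Mathlib

/-- The vertex set `{0,1}^n` of the Hamming cube `Q_n`. -/
abbrev Cube (n : ℕ) : Type := Fin n → Bool

namespace Cube

variable {n : ℕ}

/-- `x^i`: the vertex obtained from `x` by flipping its `i`-th coordinate. -/
def flip (x : Cube n) (i : Fin n) : Cube n := Function.update x i (!(x i))

/-- The Hamming cube `Q_n` as a graph: two vertices are adjacent iff they differ in exactly
one coordinate. -/
def graph (n : ℕ) : SimpleGraph (Cube n) where
  Adj x y := hammingDist x y = 1
  symm := ⟨fun x y h => by rw [hammingDist_comm]; exact h⟩
  loopless := ⟨fun x h => by simp at h⟩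

instance : DecidableRel (graph n).Adj := fun x y =>
  inferInstanceAs (Decidable (hammingDist x y = 1))

/-- `d_T(x)`: the number of neighbours of `x` in `T`. -/
def deg (T : Finset (Cube n)) (x : Cube n) : ℕ := (T.filter fun y => (graph n).Adj x y).card

/-- `h_S(x)`: the number of neighbours of `x` outside `S` if `x ∈ S`, and `0` if `x ∉ S`. -/
def h (S : Finset (Cube n)) (x : Cube n) : ℕ := if x ∈ S then deg Sᶜ x else 0

/-- The uniform probability measure of a set of vertices. -/
noncomputable def mu (A : Finset (Cube n)) : ℝ := (A.card : ℝ) / 2 ^ n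

/-- The integral of a function on the cube with respect to the uniform measure. -/
noncomputable def integral (φ : Cube n → ℝ) : ℝ := ∑ x : Cube n, φ x * mu {x}

/-- `∇(A,B)`: the edges `(x,y)` with `x ∈ A` and `y ∈ B`. -/
def nabla (A B : Finset (Cube n)) : Finset (Cube n × Cube n) :=
  (A ×ˢ B).filter fun p => (graph n).Adj p.1 p.2

/-- `∇_i A`: the edges `(x, x^i)` with `x ∈ A` and `x^i ∉ A`. -/
def nablaDir (i : Fin n) (A : Finset (Cube n)) : Finset (Cube n × Cube n) :=
  (A ×ˢ Aᶜ).filter fun p => p.2 = flip p.1 i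

/-- `(A, B, W)` is a partition of the vertex set (parts may be empty). -/
def IsPartition (A B W : Finset (Cube n)) : Prop :=
  Disjoint A B ∧ Disjoint A W ∧ Disjoint B W ∧ A ∪ B ∪ W = Finset.univ

/-- `C` is a codimension `k` subcube: the set of all vertices with prescribed values on some
set `I` of `k` coordinates. -/
def IsSubcube (k : ℕ) (C : Finset (Cube n)) : Prop :=
  ∃ I : Finset (Fin n), I.card = k ∧ ∃ z : Cube n,
    C = Finset.univ.filter fun x => ∀ i ∈ I, x i = z i

end Cube

/-! The operator `avg R` is the conditional expectation that averages out the coordinates in `R`.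
The engine of the proof is `profile_avg_le`: a set `S` of measure `m` satisfies `∫_S √(X + h_S) ≥ m
√(X + log₂(1/m))` for `X ≥ 1`. It follows from a two-point inequality by induction on the dimension.
For large `X` it linearizes to the edge-isoperimetric inequality with bound `m log₂(1/m)`. The
advantage of the square root is that a vertex of `W` contributes an error of order `√n` instead of
`n`. Testing the assumed inequality on Hamming balls of measure near `2^{-k}` gives `f(n) ≥ c√n`, so
`μ(W) ≤ ε/f(n)` makes `√n μ(W)` of order `ε`.

Qualitative stability (`exists_subcube_close`). Let `S = A ∪ W` have measure `m`, and split the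
directions into `R` and its complement. Applying the inequality inside both families of sections
shows that, when the number of edges is almost minimal, the two section entropies sum to almost the
entropy of `S`. Exchanging `A` and `B` strengthens `-a log a` to its maximum with `-(1-a) log(1-a)`
for one family. This forces `U(R)`, the mean of `(avg R 1_S)²`, to be near `m` or at most about
`m/2` (`avg_sq_dichotomy`). Since `U(∅) = m` and `U(N) = m²`, adding coordinates one at a time meets
a coordinate `i` at which `U` drops. Up to small measure, `S` then lies in one half-cube in
direction `i` (`exists_half_of_cuts`). Passing to that half lowers `k` by one.

Linear stability (`avg_abs_sub_subcube_le`). Once `A` is close to a subcube `C`, the set `B ∩ C` is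
so sparse in `C` that it creates at least `2k + 2` times its measure in edges inside `C`, up to an
error from `W`. Through the `k` faces it can save at most `2k` times its measure, up to `O(ε)`.
Hence its measure is `O(ε)`. For `ε` above a fixed threshold the theorem is trivial for large `K`.
-/

namespace Cube

variable {n : ℕ}

/-! ### Averages over subcubes as conditional expectations -/

/-- The vertex obtained from `x` by flipping all coordinates in `T`. -/
def flipSet (T : Finset (Fin n)) (x : Cube n) : Cube n := fun j => if j ∈ T then !x j else x j

/-- The average of `φ` over the subcube through `x` with free coordinates `R`. -/
noncomputable def avg (R : Finset (Fin n)) (φ : Cube n → ℝ) (x : Cube n) : ℝ :=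
  (∑ T ∈ R.powerset, φ (flipSet T x)) / 2 ^ R.card

/-- The indicator function of a set of vertices. -/
noncomputable def ind (S : Finset (Cube n)) (x : Cube n) : ℝ := if x ∈ S then 1 else 0

theorem flip_apply (x : Cube n) (i j : Fin n) : flip x i j = if j = i then !x j else x j := by
  unfold flip
  by_cases h : j = i
  · subst h; simp
  · simp [h]

theorem flip_flip (x : Cube n) (i : Fin n) : flip (flip x i) i = x := by
  funext j
  simp only [flip_apply]
  split_ifs <;> simp

theorem flipSet_empty (x : Cube n) : flipSet ∅ x = x := by
  funext j; simp [flipSet]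

theorem flipSet_flip (T : Finset (Fin n)) (x : Cube n) (i : Fin n) :
    flipSet T (flip x i) = flip (flipSet T x) i := by
  funext j
  simp only [flipSet, flip_apply]
  split_ifs <;> simp

theorem flipSet_insert {T : Finset (Fin n)} {i : Fin n} (hi : i ∉ T) (x : Cube n) :
    flipSet (insert i T) x = flipSet T (flip x i) := by
  funext j
  simp only [flipSet, flip_apply, Finset.mem_insert]
  by_cases h : j = i
  · subst h; simp [hi]
  · simp [h]

theorem flipSet_flipSet (T : Finset (Fin n)) (x : Cube n) : flipSet T (flipSet T x) = x := by
  funext j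
  simp only [flipSet]
  split_ifs <;> simp

theorem flipSet_invariant {R T : Finset (Fin n)} {ψ : Cube n → ℝ}
    (hψ : ∀ y, ∀ i ∈ R, ψ (flip y i) = ψ y) (hT : T ⊆ R) (x : Cube n) :
    ψ (flipSet T x) = ψ x := by
  induction T using Finset.induction_on generalizing x with
  | empty => rw [flipSet_empty]
  | insert i T hi ih =>
    rw [flipSet_insert hi, ih ((Finset.subset_insert i T).trans hT),
      hψ x i (hT (Finset.mem_insert_self i T))]

theorem avg_empty (φ : Cube n → ℝ) (x : Cube n) : avg ∅ φ x = φ x := by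
  simp [avg, flipSet_empty]

theorem avg_comp_flip (R : Finset (Fin n)) (φ : Cube n → ℝ) (i : Fin n) (x : Cube n) :
    avg R (fun y => φ (flip y i)) x = avg R φ (flip x i) := by
  simp [avg, flipSet_flip]

theorem avg_insert {R : Finset (Fin n)} {i : Fin n} (hi : i ∉ R) (φ : Cube n → ℝ) (x : Cube n) :
    avg (insert i R) φ x = (avg R φ x + avg R φ (flip x i)) / 2 := by
  unfold avg
  rw [Finset.sum_powerset_insert hi, Finset.card_insert_of_notMem hi, pow_succ]
  have : ∑ t ∈ R.powerset, φ (flipSet (insert i t) x)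
      = ∑ t ∈ R.powerset, φ (flipSet t (flip x i)) := by
    refine Finset.sum_congr rfl fun t ht => ?_
    rw [flipSet_insert]
    exact fun h => hi (Finset.mem_powerset.1 ht h)
  rw [this]
  field_simp

theorem avg_flip_mem {R : Finset (Fin n)} {i : Fin n} (hi : i ∈ R) (φ : Cube n → ℝ) (x : Cube n) :
    avg R φ (flip x i) = avg R φ x := by
  rw [← Finset.insert_erase hi, avg_insert (Finset.notMem_erase i R),
    avg_insert (Finset.notMem_erase i R), flip_flip, add_comm]

theorem avg_comp_flip_mem {R : Finset (Fin n)} {i : Fin n} (hi : i ∈ R) (φ : Cube n → ℝ)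
    (x : Cube n) : avg R (fun y => φ (flip y i)) x = avg R φ x := by
  rw [avg_comp_flip, avg_flip_mem hi]

theorem avg_add (R : Finset (Fin n)) (φ ψ : Cube n → ℝ) (x : Cube n) :
    avg R (fun y => φ y + ψ y) x = avg R φ x + avg R ψ x := by
  simp [avg, Finset.sum_add_distrib, add_div]

theorem avg_const_mul (R : Finset (Fin n)) (c : ℝ) (φ : Cube n → ℝ) (x : Cube n) :
    avg R (fun y => c * φ y) x = c * avg R φ x := by
  simp [avg, ← Finset.mul_sum, mul_div_assoc]

theorem avg_sub (R : Finset (Fin n)) (φ ψ : Cube n → ℝ) (x : Cube n) :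
    avg R (fun y => φ y - ψ y) x = avg R φ x - avg R ψ x := by
  simp [avg, Finset.sum_sub_distrib, sub_div]

theorem avg_const (R : Finset (Fin n)) (c : ℝ) (x : Cube n) : avg R (fun _ => c) x = c := by
  simp [avg, Finset.card_powerset]

theorem avg_sum {ι : Type*} (R : Finset (Fin n)) (I : Finset ι) (φ : ι → Cube n → ℝ) (x : Cube n) :
    avg R (fun y => ∑ i ∈ I, φ i y) x = ∑ i ∈ I, avg R (φ i) x := by
  unfold avg
  rw [Finset.sum_comm, Finset.sum_div]

theorem avg_mono (R : Finset (Fin n)) {φ ψ : Cube n → ℝ} (h : ∀ y, φ y ≤ ψ y) (x : Cube n) :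
    avg R φ x ≤ avg R ψ x := by
  unfold avg
  gcongr
  exact h _

theorem avg_nonneg (R : Finset (Fin n)) {φ : Cube n → ℝ} (h : ∀ y, 0 ≤ φ y) (x : Cube n) :
    0 ≤ avg R φ x := by
  have := avg_mono R h x
  rwa [avg_const] at this

theorem avg_le_one (R : Finset (Fin n)) {φ : Cube n → ℝ} (h : ∀ y, φ y ≤ 1) (x : Cube n) :
    avg R φ x ≤ 1 := by
  have := avg_mono R h x
  rwa [avg_const] at this

theorem avg_mul_left {R : Finset (Fin n)} {ψ : Cube n → ℝ}
    (hψ : ∀ y, ∀ i ∈ R, ψ (flip y i) = ψ y) (φ : Cube n → ℝ) (x : Cube n) :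
    avg R (fun y => ψ y * φ y) x = ψ x * avg R φ x := by
  unfold avg
  rw [mul_div_assoc', Finset.mul_sum]
  congr 1
  refine Finset.sum_congr rfl fun T hT => ?_
  simp only [flipSet_invariant hψ (Finset.mem_powerset.1 hT)]

theorem avg_of_invariant {R : Finset (Fin n)} {ψ : Cube n → ℝ}
    (hψ : ∀ y, ∀ i ∈ R, ψ (flip y i) = ψ y) (x : Cube n) : avg R ψ x = ψ x := by
  have := avg_mul_left hψ (fun _ => 1) x
  simpa [avg_const] using this

theorem avg_union {R T : Finset (Fin n)} (h : Disjoint R T) (φ : Cube n → ℝ) (x : Cube n) :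
    avg (R ∪ T) φ x = avg R (avg T φ) x := by
  induction R using Finset.induction_on generalizing x with
  | empty => simp [avg_empty]
  | insert i R hi ih =>
    rw [Finset.disjoint_insert_left] at h
    rw [Finset.insert_union, avg_insert (by simp [hi, h.1]), avg_insert hi, ih h.2, ih h.2]

theorem avg_avg_of_subset {R N : Finset (Fin n)} (h : R ⊆ N) (φ : Cube n → ℝ) (x : Cube n) :
    avg N (avg R φ) x = avg N φ x := by
  have e : avg R (avg R φ) = avg R φ := by
    funext y
    exact avg_of_invariant (fun z i hi => avg_flip_mem hi φ z) y
  rw [← Finset.sdiff_union_of_subset h, avg_union Finset.sdiff_disjoint,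
    avg_union Finset.sdiff_disjoint, e]

theorem avg_comp_flipSet {T N : Finset (Fin n)} (h : T ⊆ N) (φ : Cube n → ℝ) (x : Cube n) :
    avg N (fun y => φ (flipSet T y)) x = avg N φ x := by
  induction T using Finset.induction_on generalizing φ with
  | empty => simp [flipSet_empty]
  | insert i T hi ih =>
    have h1 : T ⊆ N := (Finset.subset_insert i T).trans h
    have : (fun y => φ (flipSet (insert i T) y)) = fun y => (fun z => φ (flip z i)) (flipSet T y) := by
      funext y
      rw [flipSet_insert hi, flipSet_flip]
    rw [this, ih h1 (fun z => φ (flip z i)), avg_comp_flip_mem (h (Finset.mem_insert_self i T))]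

theorem flipSet_univ_bijective (x : Cube n) :
    Function.Bijective fun T : Finset (Fin n) => flipSet T x := by
  constructor
  · intro T T' h
    ext j
    have := congrFun h j
    simp only [flipSet] at this
    by_cases h1 : j ∈ T <;> by_cases h2 : j ∈ T' <;> simp_all
  · intro y
    refine ⟨Finset.univ.filter fun j => y j ≠ x j, ?_⟩
    funext j
    simp only [flipSet, Finset.mem_filter, Finset.mem_univ, true_and]
    by_cases h : y j = x j
    · simp [h]
    · simp only [ne_eq, h, not_false_eq_true, if_true]
      cases hy : y j <;> cases hx : x j <;> simp_all

theorem avg_univ (φ : Cube n → ℝ) (x : Cube n) :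
    avg Finset.univ φ x = (∑ y, φ y) / 2 ^ n := by
  unfold avg
  rw [Finset.powerset_univ, Finset.card_univ, Fintype.card_fin]
  congr 1
  exact (flipSet_univ_bijective x).sum_comp φ

theorem ind_nonneg (S : Finset (Cube n)) (x : Cube n) : 0 ≤ ind S x := by
  unfold ind; split_ifs <;> simp

theorem ind_le_one (S : Finset (Cube n)) (x : Cube n) : ind S x ≤ 1 := by
  unfold ind; split_ifs <;> simp

theorem ind_eq_zero_or_one (S : Finset (Cube n)) (x : Cube n) : ind S x = 0 ∨ ind S x = 1 := by
  unfold ind; split_ifs <;> simp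

theorem mu_eq_avg (S : Finset (Cube n)) (x : Cube n) : mu S = avg Finset.univ (ind S) x := by
  rw [avg_univ]
  simp [mu, ind]

/-! ### The two-point inequality -/

theorem mul_log_two_le_log_one_add {u : ℝ} (h0 : 0 ≤ u) (h1 : u ≤ 1) :
    u * Real.log 2 ≤ Real.log (1 + u) := by
  have h := strictConcaveOn_log_Ioi.concaveOn.2 (show (1 : ℝ) ∈ Set.Ioi 0 by simp)
    (show (2 : ℝ) ∈ Set.Ioi 0 by simp) (sub_nonneg.2 h1) h0 (by ring)
  simp only [smul_eq_mul, Real.log_one, mul_zero, zero_add] at h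
  rwa [show 1 + u = (1 - u) * 1 + u * 2 by ring]

/-- The right side is the gap left in the two-point inequality in the limit of large `Y`. Its
quantitative lower bound is what pays for the concavity of the square root at finite `Y`. -/
theorem entropy_gap {u : ℝ} (h0 : 0 < u) (h1 : u ≤ 1) :
    u * (1 - u) * (-Real.log u / Real.log 2) / 4 ≤ (1 - u) ^ 2 + u * (-Real.log u / Real.log 2)
      - (1 + u) * (1 - Real.log (1 + u) / Real.log 2) := by
  have hl : 0 < Real.log 2 := Real.log_pos (by norm_num)
  have hl2 : 1 / 2 < Real.log 2 := by have := Real.log_two_gt_d9; linarith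
  set l := Real.log 2 with hldef
  -- `G u` is the right side minus the left side, divided by `u`. It decreases to `G 1 = 0`, hence
  -- is nonnegative.
  let G : ℝ → ℝ := fun t => t - 3 + (1 + 1 / t) * (Real.log (1 + t) / l) - Real.log t / l
    + (1 - t) * (Real.log t / l) / 4
  have hG : ∀ t, 0 < t → HasDerivAt G (1 - Real.log (1 + t) / (l * t ^ 2)
      - Real.log t / l / 4 + (1 - t) / (t * l) / 4) t := by
    intro t ht
    have e1 : HasDerivAt (fun t : ℝ => Real.log (1 + t) / l) (1 / (1 + t) / l) t :=
      (((hasDerivAt_id t).const_add 1).log (by simp; linarith)).div_const l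
    have e2 : HasDerivAt (fun t : ℝ => Real.log t / l) (t⁻¹ / l) t :=
      (Real.hasDerivAt_log ht.ne').div_const l
    have e3 : HasDerivAt (fun t : ℝ => 1 + 1 / t) (-1 / t ^ 2) t := by
      have := (hasDerivAt_inv ht.ne').const_add 1
      simp only [one_div]
      exact this.congr_deriv (by field_simp)
    have := ((((hasDerivAt_id t).sub_const 3).add (e3.mul e1)).sub e2).add
      ((((hasDerivAt_id t).const_sub 1).mul e2).div_const 4)
    refine this.congr_deriv ?_
    simp only [id]
    field_simp
    ring
  have hanti : AntitoneOn G (Set.Icc u 1) := by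
    refine antitoneOn_of_deriv_nonpos (convex_Icc u 1)
      (fun t ht => (hG t (h0.trans_le ht.1)).continuousAt.continuousWithinAt)
      (fun t ht => ?_) (fun t ht => ?_)
    · rw [interior_Icc] at ht
      exact (hG t (h0.trans ht.1)).differentiableAt.differentiableWithinAt
    · rw [interior_Icc] at ht
      have ht0 : 0 < t := h0.trans ht.1
      rw [(hG t ht0).deriv]
      have k1 := mul_log_two_le_log_one_add ht0.le ht.2.le
      have k2 : -Real.log t ≤ (1 - t) / t := by
        have := Real.one_sub_inv_le_log_of_pos ht0
        have e : (1 - t) / t = t⁻¹ - 1 := by field_simp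
        rw [e]; linarith
      have k3 : 1 / t ≤ Real.log (1 + t) / (l * t ^ 2) := by
        rw [div_le_div_iff₀ ht0 (by positivity)]
        nlinarith
      have k4 : -Real.log t / l ≤ (1 - t) / t / l := by gcongr
      have k5 : (1 - t) / (t * l) = (1 - t) / t / l := by field_simp
      have k6 : (1 - t) / t / l ≤ 2 * ((1 - t) / t) := by
        rw [div_le_iff₀ hl]
        have : 0 ≤ (1 - t) / t := div_nonneg (by linarith [ht.2]) ht0.le
        nlinarith
      have k7 : (1 - t) / t = 1 / t - 1 := by field_simp
      have k8 : -Real.log t / l = -(Real.log t / l) := by ring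
      rw [k5]
      linarith
  have hG1 : G 1 = 0 := by
    simp only [G]
    norm_num
    rw [← hldef, div_self hl.ne']; norm_num
  have h := hanti (Set.left_mem_Icc.2 h1) (Set.right_mem_Icc.2 h1) h1
  rw [hG1] at h
  have hm := mul_nonneg h0.le h
  simp only [G] at hm
  have e : u * (u - 3 + (1 + 1 / u) * (Real.log (1 + u) / l) - Real.log u / l
    + (1 - u) * (Real.log u / l) / 4) = u ^ 2 - 3 * u + (1 + u) * (Real.log (1 + u) / l)
    - u * (Real.log u / l) + u * (1 - u) * (Real.log u / l) / 4 := by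
    field_simp
    ring
  rw [e] at hm
  rw [neg_div]
  nlinarith

/-- The two-point inequality in normalized form. -/
theorem two_point_normalized {u Y : ℝ} (h0 : 0 < u) (h1 : u ≤ 1) (hY : 1 ≤ Y) :
    (1 + u) * √(Y + (1 - Real.log (1 + u) / Real.log 2)) ≤
      √(Y + (1 - u) ^ 2) + u * √(Y + -Real.log u / Real.log 2) := by
  have hl : 0 < Real.log 2 := Real.log_pos (by norm_num)
  have hs := entropy_gap h0 h1
  set α := 1 - Real.log (1 + u) / Real.log 2 with hα
  set β := -Real.log u / Real.log 2 with hβ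
  have hα1 : α ≤ 1 - u := by
    have := (le_div_iff₀ hl).2 (mul_log_two_le_log_one_add h0.le h1)
    linarith
  have hα0 : 0 ≤ α := by
    have : Real.log (1 + u) / Real.log 2 ≤ 1 := by
      rw [div_le_one hl]
      exact Real.log_le_log (by linarith) (by linarith)
    linarith
  have hβα : α ≤ β := by
    have : Real.log 2 + Real.log u ≤ Real.log (1 + u) := by
      rw [← Real.log_mul (by norm_num) h0.ne']
      exact Real.log_le_log (by linarith) (by linarith)
    have h2 := div_le_div_of_nonneg_right this hl.le
    rw [add_div, div_self hl.ne'] at h2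
    rw [hα, hβ, neg_div]
    linarith
  have hβ0 : 0 ≤ β := hα0.trans hβα
  have hsq : 0 ≤ (1 - u) ^ 2 := sq_nonneg _
  have ha2 : √(Y + (1 - u) ^ 2) ^ 2 = Y + (1 - u) ^ 2 := Real.sq_sqrt (by linarith)
  have hb2 : √(Y + β) ^ 2 = Y + β := Real.sq_sqrt (by linarith)
  have hw2 : √(Y + α) ^ 2 = Y + α := Real.sq_sqrt (by linarith)
  have ha : 1 ≤ √(Y + (1 - u) ^ 2) := Real.one_le_sqrt.2 (by linarith)
  have hb : 1 ≤ √(Y + β) := Real.one_le_sqrt.2 (by linarith)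
  have hw : 1 ≤ √(Y + α) := Real.one_le_sqrt.2 (by linarith)
  have hwb : √(Y + α) ≤ √(Y + β) := Real.sqrt_le_sqrt (by linarith)
  -- In the first case both radicands on the right dominate the one on the left.
  rcases le_total α ((1 - u) ^ 2) with h | h
  · have : √(Y + α) ≤ √(Y + (1 - u) ^ 2) := Real.sqrt_le_sqrt (by linarith)
    nlinarith
  · have haw : √(Y + (1 - u) ^ 2) ≤ √(Y + α) := Real.sqrt_le_sqrt (by linarith)
    set a := √(Y + (1 - u) ^ 2)
    set b := √(Y + β)
    set w := √(Y + α)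
    set s := (1 - u) ^ 2 + u * β - (1 + u) * α with hsdef
    set e := α - (1 - u) ^ 2 with he
    have he0 : 0 ≤ e := by linarith
    have he1 : e ≤ u * (1 - u) := by nlinarith
    have hab : b - a ≤ β / 2 := by
      have : (b - a) * (a + b) ≤ β := by nlinarith
      nlinarith
    have hs0 : 0 ≤ s := le_trans (by
      have : 0 ≤ u * (1 - u) * β := mul_nonneg (mul_nonneg h0.le (by linarith)) hβ0
      linarith) hs
    have hfin : e * (b - a) ≤ s * (a + w) := by
      calc e * (b - a) ≤ (u * (1 - u)) * (β / 2) :=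
            mul_le_mul he1 hab (by linarith) (mul_nonneg h0.le (by linarith))
        _ ≤ s * 2 := by linarith
        _ ≤ s * (a + w) := by gcongr; linarith
    -- Multiplying by the conjugates removes the differences of roots and leaves `s * (a + w) - e *
    -- (b - a)`, which `hfin` controls.
    have key : 0 ≤ (u * (b - w) - (w - a)) * ((b + w) * (a + w)) := by
      have : (u * (b - w) - (w - a)) * ((b + w) * (a + w))
          = u * (b ^ 2 - w ^ 2) * (a + w) - (w ^ 2 - a ^ 2) * (b + w) := by ring
      rw [this, hb2, hw2, ha2]
      have : u * (Y + β - (Y + α)) * (a + w) - (Y + α - (Y + (1 - u) ^ 2)) * (b + w)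
          = s * (a + w) - e * (b - a) := by rw [hsdef, he]; ring
      rw [this]; linarith
    have := nonneg_of_mul_nonneg_left key (by positivity)
    linarith

/-- The isoperimetric profile `a √(X + log₂(1/a))`. -/
noncomputable def profile (X a : ℝ) : ℝ := a * √(X - Real.log a / Real.log 2)

theorem profile_zero (X : ℝ) : profile X 0 = 0 := by simp [profile]

theorem profile_nonneg (X : ℝ) {a : ℝ} (ha : 0 ≤ a) : 0 ≤ profile X a :=
  mul_nonneg ha (Real.sqrt_nonneg _)

/-- By homogeneity, put `q = p * u` and absorb `log p` into `X`; this is the normalized inequality.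
Equality at `q = 0` is what makes the resulting bound exact for subcubes. -/
theorem two_point {X p q : ℝ} (hX : 1 ≤ X) (hq : 0 ≤ q) (hqp : q ≤ p) (hp : p ≤ 1) :
    2 * profile X ((p + q) / 2) ≤ √(profile X p ^ 2 + (p - q) ^ 2) + profile X q := by
  have hl : 0 < Real.log 2 := Real.log_pos (by norm_num)
  rcases (hq.trans hqp).eq_or_lt with hp0 | hp0
  · have : q = 0 := le_antisymm (hqp.trans hp0.symm.le) hq
    subst this; rw [← hp0]; simp [profile]
  set Y := X - Real.log p / Real.log 2 with hYdef
  have hY : 1 ≤ Y := by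
    have := div_nonpos_of_nonpos_of_nonneg (Real.log_nonpos hp0.le hp) hl.le
    linarith
  have hprof : ∀ u : ℝ, 0 ≤ u → √(profile X p ^ 2 + (p - p * u) ^ 2) = p * √(Y + (1 - u) ^ 2) := by
    intro u hu
    rw [profile, ← hYdef, mul_pow, Real.sq_sqrt (by linarith)]
    have : p ^ 2 * Y + (p - p * u) ^ 2 = p ^ 2 * (Y + (1 - u) ^ 2) := by ring
    rw [this, Real.sqrt_mul (sq_nonneg _), Real.sqrt_sq hp0.le]
  rcases hq.eq_or_lt with hq0 | hq0
  · subst hq0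
    have h1 := hprof 0 le_rfl
    rw [mul_zero] at h1
    rw [h1, profile_zero, add_zero, profile, add_zero, Real.log_div hp0.ne' (by norm_num),
      sub_div, div_self hl.ne']
    have : X - (Real.log p / Real.log 2 - 1) = Y + (1 - 0) ^ 2 := by rw [hYdef]; ring
    rw [this]
    linarith
  · obtain ⟨u, rfl⟩ : ∃ u, q = p * u := ⟨q / p, by field_simp⟩
    have hu0 : 0 < u := pos_of_mul_pos_right hq0 hp0.le
    have hu1 : u ≤ 1 := by
      by_contra h
      push Not at h
      nlinarith
    rw [hprof u hu0.le]
    have e1 : profile X ((p + p * u) / 2) = p * (1 + u) / 2 *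
        √(Y + (1 - Real.log (1 + u) / Real.log 2)) := by
      have : (p + p * u) / 2 = p * (1 + u) / 2 := by ring
      rw [profile, this, Real.log_div (by positivity) (by norm_num),
        Real.log_mul hp0.ne' (by positivity)]
      congr 2
      rw [hYdef]; field_simp; ring
    have e2 : profile X (p * u) = p * u * √(Y + -Real.log u / Real.log 2) := by
      rw [profile, Real.log_mul hp0.ne' hu0.ne']
      congr 2
      rw [hYdef]; field_simp; ring
    rw [e1, e2]
    have := mul_le_mul_of_nonneg_left (two_point_normalized hu0 hu1 hY) hp0.le
    linarith

/-! ### The isoperimetric inequality for `√(X + h)` -/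

/-- Minkowski's inequality for averages of plane vectors. -/
theorem sqrt_avg_sq_add_le (R : Finset (Fin n)) (f g : Cube n → ℝ) (x : Cube n) :
    √(avg R f x ^ 2 + avg R g x ^ 2) ≤ avg R (fun y => √(f y ^ 2 + g y ^ 2)) x := by
  set F := avg R f x
  set G := avg R g x
  set r := √(F ^ 2 + G ^ 2) with hr
  have hr0 : 0 ≤ r := Real.sqrt_nonneg _
  have hA : 0 ≤ avg R (fun y => √(f y ^ 2 + g y ^ 2)) x :=
    avg_nonneg R (fun y => Real.sqrt_nonneg _) x
  rcases hr0.eq_or_lt with h | h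
  · rw [← h]; exact hA
  have h2 : r ^ 2 = F ^ 2 + G ^ 2 := Real.sq_sqrt (by positivity)
  -- Project each vector onto the direction `(F, G)` of the mean and apply Cauchy–Schwarz pointwise.
  have h3 : avg R (fun y => F * f y + G * g y) x ≤ avg R (fun y => r * √(f y ^ 2 + g y ^ 2)) x := by
    refine avg_mono R (fun y => ?_) x
    rw [hr, ← Real.sqrt_mul (by positivity)]
    refine Real.le_sqrt_of_sq_le ?_
    nlinarith [sq_nonneg (F * g y - G * f y)]
  rw [avg_add, avg_const_mul, avg_const_mul, avg_const_mul] at h3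
  have : r * r ≤ r * avg R (fun y => √(f y ^ 2 + g y ^ 2)) x := by
    calc r * r = F * F + G * G := by rw [← sq, h2]; ring
      _ ≤ _ := h3
  exact le_of_mul_le_mul_left this h

/-- An isoperimetric inequality for `∫ √(X + h)`, sharp for all subcubes. -/
theorem profile_avg_le {X : ℝ} (hX : 1 ≤ X) {s : Cube n → ℝ} (hs : ∀ y, s y = 0 ∨ s y = 1)
    (R : Finset (Fin n)) (x : Cube n) :
    profile X (avg R s x) ≤ avg R (fun y => s y * √(X + ∑ i ∈ R, (1 - s (flip y i)))) x := by
  have hs0 : ∀ y, 0 ≤ s y := fun y => by rcases hs y with h | h <;> simp [h]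
  have hs1 : ∀ y, s y ≤ 1 := fun y => by rcases hs y with h | h <;> simp [h]
  induction R using Finset.induction_on generalizing x with
  | empty =>
    rw [avg_empty, avg_empty]
    rcases hs x with h | h <;> simp [h, profile]
  | insert i R hi ih =>
    -- Boundary edges in direction `i` are counted only in the denser half. There they form the
    -- second component of the vector in Minkowski's inequality, of mean at least the difference of
    -- the densities; in the other half they are discarded.
    have main : ∀ x, avg R s (flip x i) ≤ avg R s x →
        2 * profile X ((avg R s x + avg R s (flip x i)) / 2) ≤
        avg R (fun y => s y * √(X + ∑ j ∈ insert i R, (1 - s (flip y j)))) x +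
        avg R (fun y => s y * √(X + ∑ j ∈ insert i R, (1 - s (flip y j)))) (flip x i) := by
      intro x hx
      refine (two_point hX (avg_nonneg R hs0 _) hx (avg_le_one R hs1 x)).trans ?_
      refine add_le_add ?_ ((ih _).trans ?_)
      · have hM := sqrt_avg_sq_add_le R (fun y => s y * √(X + ∑ j ∈ R, (1 - s (flip y j))))
          (fun y => s y * (1 - s (flip y i))) x
        have hd : avg R s x - avg R s (flip x i) ≤ avg R (fun y => s y * (1 - s (flip y i))) x := by
          rw [← avg_comp_flip, ← avg_sub]
          refine avg_mono R (fun y => ?_) x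
          have := hs0 (flip y i)
          have := hs1 y
          nlinarith
        refine (Real.sqrt_le_sqrt ?_).trans (hM.trans (le_of_eq ?_))
        · have h1 := pow_le_pow_left₀ (profile_nonneg X (avg_nonneg R hs0 x)) (ih x) 2
          have h2 := pow_le_pow_left₀ (sub_nonneg.2 hx) hd 2
          linarith
        · congr 1
          funext y
          have hnn : 0 ≤ ∑ j ∈ R, (1 - s (flip y j)) :=
            Finset.sum_nonneg fun j _ => by linarith [hs1 (flip y j)]
          rw [Finset.sum_insert hi]
          rcases hs y with h | h
          · simp [h]
          · rw [h, one_mul, one_mul, one_mul, Real.sq_sqrt (by linarith)]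
            congr 1
            rcases hs (flip y i) with h' | h' <;> rw [h'] <;> ring
      · refine avg_mono R (fun y => ?_) _
        refine mul_le_mul_of_nonneg_left (Real.sqrt_le_sqrt ?_) (hs0 y)
        rw [Finset.sum_insert hi]
        linarith [hs1 (flip y i)]
    rw [avg_insert hi, avg_insert hi]
    rcases le_total (avg R s (flip x i)) (avg R s x) with h | h
    · linarith [main x h]
    · have := main (flip x i) (by rwa [flip_flip])
      rw [flip_flip, add_comm (avg R s (flip x i))] at this
      linarith

/-! ### Edge counts bound section entropies -/

/-- The normalized number of edges in directions `R` between `A` and `B`, in the subcube through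
`x` with free coordinates `R`. -/
noncomputable def edgeDensity (R : Finset (Fin n)) (A B : Finset (Cube n)) (x : Cube n) : ℝ :=
  avg R (fun y => ind A y * ∑ i ∈ R, ind B (flip y i)) x

theorem edgeDensity_comm (R : Finset (Fin n)) (A B : Finset (Cube n)) (x : Cube n) :
    edgeDensity R A B x = edgeDensity R B A x := by
  unfold edgeDensity
  simp only [Finset.mul_sum]
  rw [avg_sum, avg_sum]
  refine Finset.sum_congr rfl fun i hi => ?_
  rw [← avg_comp_flip_mem hi]
  simp only [flip_flip]
  congr 1
  funext y
  ring

theorem IsPartition.ind_add {A B W : Finset (Cube n)} (h : IsPartition A B W) (x : Cube n) :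
    ind A x + ind B x + ind W x = 1 := by
  obtain ⟨h1, h2, h3, h4⟩ := h
  have hx : x ∈ A ∪ B ∪ W := h4 ▸ Finset.mem_univ x
  rw [Finset.mem_union, Finset.mem_union] at hx
  unfold ind
  rcases hx with (hx | hx) | hx
  · have a := Finset.disjoint_left.1 h1 hx
    have b := Finset.disjoint_left.1 h2 hx
    simp [hx, a, b]
  · have a := Finset.disjoint_right.1 h1 hx
    have b := Finset.disjoint_left.1 h3 hx
    simp [hx, a, b]
  · have a := Finset.disjoint_right.1 h2 hx
    have b := Finset.disjoint_right.1 h3 hx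
    simp [hx, a, b]

theorem IsPartition.swap {A B W : Finset (Cube n)} (h : IsPartition A B W) :
    IsPartition B A W :=
  ⟨h.1.symm, h.2.2.1, h.2.1, by rw [Finset.union_comm B A]; exact h.2.2.2⟩

theorem IsPartition.avg_add {A B W : Finset (Cube n)} (h : IsPartition A B W)
    (R : Finset (Fin n)) (x : Cube n) :
    avg R (ind A) x + avg R (ind B) x + avg R (ind W) x = 1 := by
  rw [← Cube.avg_add, ← Cube.avg_add]
  simp only [h.ind_add, avg_const]

theorem one_sub_ind (B : Finset (Cube n)) (x : Cube n) : 1 - ind B x = 0 ∨ 1 - ind B x = 1 := by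
  rcases ind_eq_zero_or_one B x with h | h <;> simp [h]

theorem avg_one_sub_ind (R : Finset (Fin n)) (B : Finset (Cube n)) (x : Cube n) :
    avg R (fun y => 1 - ind B y) x = 1 - avg R (ind B) x := by
  rw [avg_sub, avg_const]

/-- The isoperimetric inequality is applied to the complement of `B`. On `A` the root is bounded by
its tangent at `X`, which produces the edge count; on `W` it is bounded by `√X + √n`. -/
theorem profile_le_edgeDensity {A B W : Finset (Cube n)} (h : IsPartition A B W) {X : ℝ}
    (hX : 1 ≤ X) (R : Finset (Fin n)) (x : Cube n) :
    2 * √X * (profile X (1 - avg R (ind B) x) - √X * (1 - avg R (ind B) x)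
      - √n * avg R (ind W) x) ≤ edgeDensity R A B x := by
  have hX0 : 0 < √X := Real.sqrt_pos.2 (by linarith)
  have hXX : √X ^ 2 = X := Real.sq_sqrt (by linarith)
  have h1 := profile_avg_le hX (one_sub_ind B) R x
  have h2 : avg R (fun y => (1 - ind B y) * √(X + ∑ i ∈ R, (1 - (1 - ind B (flip y i))))) x ≤
      avg R (fun y => (√X * (1 - ind B y) + (2 * √X)⁻¹ * (ind A y * ∑ i ∈ R, ind B (flip y i)))
        + √n * ind W y) x := by
    refine avg_mono R (fun y => ?_) x
    simp only [sub_sub_cancel]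
    have hd0 : 0 ≤ ∑ i ∈ R, ind B (flip y i) := Finset.sum_nonneg fun i _ => ind_nonneg _ _
    have hdn : ∑ i ∈ R, ind B (flip y i) ≤ n := by
      calc ∑ i ∈ R, ind B (flip y i) ≤ ∑ i ∈ R, (1 : ℝ) :=
            Finset.sum_le_sum fun i _ => ind_le_one _ _
        _ = R.card := by simp
        _ ≤ n := by exact_mod_cast (Finset.card_le_univ R).trans_eq (by simp)
    set d := ∑ i ∈ R, ind B (flip y i)
    have e1 : √(X + d) ≤ √X + (2 * √X)⁻¹ * d := by
      refine Real.sqrt_le_iff.2 ⟨by positivity, ?_⟩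
      have : (√X + (2 * √X)⁻¹ * d) ^ 2 = √X ^ 2 + d + ((2 * √X)⁻¹ * d) ^ 2 := by
        field_simp
        ring
      rw [this, hXX]
      linarith [sq_nonneg ((2 * √X)⁻¹ * d)]
    have e2 : √(X + d) ≤ √X + √n := by
      refine Real.sqrt_le_iff.2 ⟨by positivity, ?_⟩
      have hn : √(n : ℝ) ^ 2 = n := Real.sq_sqrt (by positivity)
      have : 0 ≤ √X * √n := by positivity
      nlinarith
    have hp := h.ind_add y
    have hA := ind_nonneg A y
    have hW := ind_nonneg W y
    have : 1 - ind B y = ind A y + ind W y := by linarith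
    rw [this]
    have f1 := mul_le_mul_of_nonneg_left e1 hA
    have f2 := mul_le_mul_of_nonneg_left e2 hW
    linarith
  rw [Cube.avg_add, Cube.avg_add, avg_const_mul, avg_const_mul, avg_const_mul,
    avg_one_sub_ind] at h2
  rw [avg_one_sub_ind] at h1
  have h3 : profile X (1 - avg R (ind B) x) - √X * (1 - avg R (ind B) x) - √n * avg R (ind W) x
      ≤ (2 * √X)⁻¹ * edgeDensity R A B x := by
    unfold edgeDensity
    linarith
  calc _ ≤ 2 * √X * ((2 * √X)⁻¹ * edgeDensity R A B x) := by gcongr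
    _ = _ := by field_simp

theorem mul_log_sq_le {a : ℝ} (ha : 0 < a) (ha1 : a ≤ 1) : a * Real.log a ^ 2 ≤ 4 := by
  have hs : 0 < √a := Real.sqrt_pos.2 ha
  have h1 : Real.log a = 2 * Real.log √a := by
    rw [Real.log_sqrt ha.le]; ring
  have h2 : -Real.log √a ≤ (√a)⁻¹ := by
    have := Real.one_sub_inv_le_log_of_pos hs
    linarith
  have h3 : 0 ≤ -Real.log √a := by
    have := Real.log_nonpos hs.le (Real.sqrt_le_one.2 ha1)
    linarith
  have h4 := pow_le_pow_left₀ h3 h2 2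
  rw [h1, mul_pow, ← neg_sq (Real.log √a)]
  rw [inv_pow, Real.sq_sqrt ha.le] at h4
  calc a * (2 ^ 2 * (-Real.log √a) ^ 2) ≤ a * (2 ^ 2 * a⁻¹) := by gcongr
    _ = 4 := by field_simp; norm_num

theorem sqrt_mul_sqrt_sub_ge {X l : ℝ} (hX : 1 ≤ X) (hl : 0 ≤ l) :
    l - l ^ 2 / (4 * X) ≤ 2 * √X * (√(X + l) - √X) := by
  have ht : 1 ≤ √X := Real.one_le_sqrt.2 hX
  have ht2 : √X ^ 2 = X := Real.sq_sqrt (by linarith)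
  have hr2 : √(X + l) ^ 2 = X + l := Real.sq_sqrt (by linarith)
  have hrt : √X ≤ √(X + l) := Real.sqrt_le_sqrt (by linarith)
  set r := √(X + l)
  set t := √X
  have h1 : 2 * t * (r - t) ≤ l := by nlinarith
  have h2 : (r - t) ^ 2 ≤ l ^ 2 / (4 * X) := by
    rw [le_div_iff₀ (by linarith), ← ht2]
    have := pow_le_pow_left₀ (mul_nonneg (by linarith) (sub_nonneg.2 hrt)) h1 2
    linarith [this]
  nlinarith

/-- Second-order expansion of the root. The error `a (log a)² / X` is uniform in `a` because `a (log
a)²` is bounded. -/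
theorem negMulLog_le_profile {X a : ℝ} (hX : 1 ≤ X) (ha : 0 ≤ a) (ha1 : a ≤ 1) :
    Real.negMulLog a / Real.log 2 - 3 / X ≤ 2 * √X * (profile X a - √X * a) := by
  have hX0 : 0 < X := by linarith
  rcases ha.eq_or_lt with h | h
  · rw [← h]
    simp [profile]
    positivity
  have hl2 : 2 / 3 < Real.log 2 := by have := Real.log_two_gt_d9; linarith
  have hl : 0 < Real.log 2 := by linarith
  have hla : 0 ≤ -Real.log a / Real.log 2 :=
    div_nonneg (by linarith [Real.log_nonpos ha ha1]) hl.le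
  have h1 := mul_le_mul_of_nonneg_left (sqrt_mul_sqrt_sub_ge hX hla) ha
  have h2 : a * ((-Real.log a / Real.log 2) ^ 2 / (4 * X)) ≤ 3 / X := by
    have h3 := mul_log_sq_le h ha1
    have : a * ((-Real.log a / Real.log 2) ^ 2 / (4 * X)) =
        (a * Real.log a ^ 2 / (4 * Real.log 2 ^ 2)) / X := by field_simp
    rw [this]
    gcongr
    rw [div_le_iff₀ (by positivity)]
    nlinarith
  have e1 : Real.negMulLog a / Real.log 2 = a * (-Real.log a / Real.log 2) := by
    rw [Real.negMulLog]; ring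
  have e2 : profile X a = a * √(X + -Real.log a / Real.log 2) := by
    rw [profile]; congr 2; ring
  rw [e1, e2]
  linarith

theorem negMulLog_add_ge {a w : ℝ} (ha : 0 ≤ a) (hw : 0 ≤ w) (h1 : a + w ≤ 1) :
    Real.negMulLog a - w ≤ Real.negMulLog (a + w) := by
  rcases ha.eq_or_lt with h | h
  · subst h
    have := Real.negMulLog_nonneg (x := 0 + w) (by linarith) h1
    simp only [Real.negMulLog_zero]
    linarith
  · unfold Real.negMulLog
    have e1 : Real.log (a + w) ≤ 0 := Real.log_nonpos (by linarith) h1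
    have e2 : a * (Real.log (a + w) - Real.log a) ≤ w := by
      rw [← Real.log_div (by linarith) h.ne']
      have := Real.log_le_sub_one_of_pos (x := (a + w) / a) (by positivity)
      calc a * Real.log ((a + w) / a) ≤ a * ((a + w) / a - 1) := by gcongr
        _ = w := by field_simp; ring
    nlinarith

theorem negMulLog_le_edgeDensity {A B W : Finset (Cube n)} (h : IsPartition A B W) {X : ℝ}
    (hX : 1 ≤ X) (R : Finset (Fin n)) (x : Cube n) :
    Real.negMulLog (1 - avg R (ind B) x)
      ≤ Real.log 2 * edgeDensity R A B x + 3 / X + 2 * √X * √n * avg R (ind W) x := by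
  have h1 := profile_le_edgeDensity h hX R x
  have hB0 := avg_nonneg R (ind_nonneg B) x
  have hB1 := avg_le_one R (ind_le_one B) x
  have hW0 := avg_nonneg R (ind_nonneg W) x
  have h2 := negMulLog_le_profile hX (a := 1 - avg R (ind B) x) (by linarith) (by linarith)
  have hl2 : Real.log 2 ≤ 1 := by have := Real.log_two_lt_d9; linarith
  have hl : 0 < Real.log 2 := Real.log_pos (by norm_num)
  have h3 : Real.negMulLog (1 - avg R (ind B) x) / Real.log 2
      ≤ edgeDensity R A B x + (3 / X + 2 * √X * √n * avg R (ind W) x) := by linarith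
  rw [div_le_iff₀ hl] at h3
  have h4 : 0 ≤ 3 / X + 2 * √X * √n * avg R (ind W) x := by positivity
  nlinarith

/-- The edge count is symmetric in `A` and `B`, so it bounds the entropy terms of the complements of
both. These overlap only in `W`, and `negMulLog_add_ge` removes `W` at a cost linear in its density.
-/
theorem max_negMulLog_le_edgeDensity {A B W : Finset (Cube n)} (h : IsPartition A B W) {X : ℝ}
    (hX : 1 ≤ X) (R : Finset (Fin n)) (x : Cube n) :
    max (Real.negMulLog (1 - avg R (ind B) x)) (Real.negMulLog (1 - (1 - avg R (ind B) x)))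
      ≤ Real.log 2 * edgeDensity R A B x + 3 / X + (2 * √X * √n + 1) * avg R (ind W) x := by
  have h1 := negMulLog_le_edgeDensity h hX R x
  have h2 := negMulLog_le_edgeDensity h.swap hX R x
  rw [edgeDensity_comm] at h2
  have hp := h.avg_add R x
  have hW0 := avg_nonneg R (ind_nonneg W) x
  have hA0 := avg_nonneg R (ind_nonneg A) x
  have hB0 := avg_nonneg R (ind_nonneg B) x
  refine max_le (by linarith) ?_
  have h3 := negMulLog_add_ge (a := avg R (ind B) x) hB0 hW0 (by linarith)
  have e : 1 - avg R (ind A) x = avg R (ind B) x + avg R (ind W) x := by linarith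
  rw [e] at h2
  rw [sub_sub_cancel]
  linarith

theorem edgeDensity_split {R N : Finset (Fin n)} (hR : R ⊆ N) (A B : Finset (Cube n))
    (x : Cube n) : edgeDensity N A B x =
      avg N (edgeDensity R A B) x + avg N (edgeDensity (N \ R) A B) x := by
  unfold edgeDensity
  have e1 := avg_avg_of_subset hR (fun y => ind A y * ∑ i ∈ R, ind B (flip y i)) x
  have e2 := avg_avg_of_subset (Finset.sdiff_subset : N \ R ⊆ N)
    (fun y => ind A y * ∑ i ∈ N \ R, ind B (flip y i)) x
  change _ = avg N (avg R (fun y => ind A y * ∑ i ∈ R, ind B (flip y i))) x +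
    avg N (avg (N \ R) (fun y => ind A y * ∑ i ∈ N \ R, ind B (flip y i))) x
  rw [e1, e2, ← avg_add]
  congr 1
  funext y
  rw [← Finset.sum_sdiff hR]
  ring

/-- The edge count of a partition bounds the entropies of both families of sections of a cut. -/
theorem section_entropy_le {A B W : Finset (Cube n)} (h : IsPartition A B W) {X : ℝ}
    (hX : 1 ≤ X) {R N : Finset (Fin n)} (hR : R ⊆ N) (x : Cube n) :
    avg N (fun y => max (Real.negMulLog (avg R (fun z => 1 - ind B z) y))
        (Real.negMulLog (1 - avg R (fun z => 1 - ind B z) y))) x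
      + avg N (fun y => Real.negMulLog (avg (N \ R) (fun z => 1 - ind B z) y)) x
      ≤ Real.log 2 * edgeDensity N A B x + 6 / X + (4 * √X * √n + 1) * avg N (ind W) x := by
  have h1 := avg_mono N (fun y => max_negMulLog_le_edgeDensity h hX R y) x
  have h2 := avg_mono N (fun y => negMulLog_le_edgeDensity h hX (N \ R) y) x
  simp only [avg_add, avg_const_mul, avg_const, avg_avg_of_subset hR,
    avg_avg_of_subset (Finset.sdiff_subset : N \ R ⊆ N)] at h1 h2
  simp only [avg_one_sub_ind]
  rw [edgeDensity_split hR]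
  have : 6 / X = 3 / X + 3 / X := by ring
  rw [this]
  linarith

/-! ### Stability of the entropy inequality for a cut -/

/-- The difference is concave on `[1/2, 1]`, vanishes at both ends and is at least `1/8` at `3/4`,
so it lies above the two chords through that point. -/
theorem negMulLog_one_sub_sub_ge {a : ℝ} (h0 : 1 / 2 ≤ a) (h1 : a ≤ 1) :
    (a - 1 / 2) * (1 - a) ≤ Real.negMulLog (1 - a) - Real.negMulLog a := by
  let D : ℝ → ℝ := fun t => Real.negMulLog (1 - t) - Real.negMulLog t
  have hD : ∀ t, 0 < t → t < 1 → HasDerivAt D (Real.log (1 - t) + Real.log t + 2) t := by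
    intro t ht ht1
    have e1 := (Real.hasDerivAt_negMulLog (x := 1 - t) (by linarith)).comp t
      ((hasDerivAt_id t).const_sub 1)
    have := e1.sub (Real.hasDerivAt_negMulLog ht.ne')
    refine this.congr_deriv ?_
    ring
  have hcont : Continuous D := by
    have := Real.continuous_negMulLog
    fun_prop
  have hconc : ConcaveOn ℝ (Set.Icc (1 / 2) 1) D := by
    refine AntitoneOn.concaveOn_of_deriv (convex_Icc _ _) hcont.continuousOn ?_ ?_
    · rw [interior_Icc]
      intro t ht
      exact (hD t (by linarith [ht.1]) ht.2).differentiableAt.differentiableWithinAt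
    · rw [interior_Icc]
      intro t ht t' ht' htt'
      have a1 : 1 / 2 < t := ht.1
      have a2 : t' < 1 := ht'.2
      rw [(hD t (by linarith) (by linarith)).deriv, (hD t' (by linarith) a2).deriv,
        ← Real.log_mul (by linarith) (by linarith), ← Real.log_mul (by linarith) (by linarith)]
      have : (1 - t') * t' ≤ (1 - t) * t := by nlinarith
      have := Real.log_le_log (mul_pos (by linarith) (by linarith)) this
      linarith
  have hhalf : D (1 / 2) = 0 := by simp only [D]; norm_num
  have hone : D 1 = 0 := by simp [D]
  have hmid : 1 / 8 ≤ D (3 / 4) := by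
    have e : D (3 / 4) = 3 / 4 * Real.log 3 - Real.log 2 := by
      have l4 : Real.log 4 = 2 * Real.log 2 := by
        rw [show (4 : ℝ) = 2 ^ 2 by norm_num, Real.log_pow]; norm_num
      simp only [D, Real.negMulLog]
      rw [show (1 : ℝ) - 3 / 4 = 1 / 4 by norm_num, Real.log_div (by norm_num) (by norm_num),
        Real.log_div (by norm_num) (by norm_num), l4, Real.log_one]
      ring
    -- The value at `3/4` is `(3/4) log 3 - log 2`; that it is at least `1/8` amounts to `e ≤
    -- 3⁶/2⁸`.
    have h : 1 ≤ Real.log (729 / 256) := by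
      rw [Real.le_log_iff_exp_le (by norm_num)]
      have := Real.exp_one_lt_d9
      linarith
    have e2 : Real.log (729 / 256) = 6 * Real.log 3 - 8 * Real.log 2 := by
      rw [Real.log_div (by norm_num) (by norm_num), show (729 : ℝ) = 3 ^ 6 by norm_num,
        show (256 : ℝ) = 2 ^ 8 by norm_num, Real.log_pow, Real.log_pow]
      norm_num
    rw [e]
    linarith
  change _ ≤ D a
  rcases le_total a (3 / 4) with h | h
  · have := hconc.2 (show (1 / 2 : ℝ) ∈ Set.Icc (1 / 2) 1 by norm_num)
      (show (3 / 4 : ℝ) ∈ Set.Icc (1 / 2) 1 by norm_num)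
      (show 0 ≤ 1 - (4 * a - 2) by linarith) (show 0 ≤ 4 * a - 2 by linarith) (by ring)
    simp only [smul_eq_mul, hhalf] at this
    rw [show (1 - (4 * a - 2)) * (1 / 2) + (4 * a - 2) * (3 / 4) = a by ring] at this
    nlinarith
  · have := hconc.2 (show (1 : ℝ) ∈ Set.Icc (1 / 2) 1 by norm_num)
      (show (3 / 4 : ℝ) ∈ Set.Icc (1 / 2) 1 by norm_num)
      (show 0 ≤ 1 - (4 - 4 * a) by linarith) (show 0 ≤ 4 - 4 * a by linarith) (by ring)
    simp only [smul_eq_mul, hone] at this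
    rw [show (1 - (4 - 4 * a)) * 1 + (4 - 4 * a) * (3 / 4) = a by ring] at this
    nlinarith

/-- The gain is taken to be a cubic polynomial, negative below `1/2`, so that its average involves
only the first three moments of the section measure. -/
theorem negMulLog_add_le_max {a : ℝ} (h0 : 0 ≤ a) (h1 : a ≤ 1) :
    Real.negMulLog a + a * (a - 1 / 2) * (1 - a) ≤
      max (Real.negMulLog a) (Real.negMulLog (1 - a)) := by
  rcases le_total a (1 / 2) with h | h
  · refine le_max_of_le_left ?_
    have : 0 ≤ a * (1 / 2 - a) * (1 - a) :=
      mul_nonneg (mul_nonneg h0 (by linarith)) (by linarith)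
    linarith
  · refine le_max_of_le_right ?_
    have := negMulLog_one_sub_sub_ge h h1
    have h2 : 0 ≤ (a - 1 / 2) * (1 - a) := mul_nonneg (by linarith) (by linarith)
    nlinarith

/-- Conditional expectation: a factor not depending on the coordinates in `R` can be pulled out of
`avg R`. -/
theorem avg_mul_avg {R N : Finset (Fin n)} (hR : R ⊆ N) {ψ : Cube n → ℝ}
    (hψ : ∀ y, ∀ i ∈ R, ψ (flip y i) = ψ y) (φ : Cube n → ℝ) (x : Cube n) :
    avg N (fun y => ψ y * avg R φ y) x = avg N (fun y => ψ y * φ y) x := by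
  rw [← avg_avg_of_subset hR (fun y => ψ y * φ y)]
  congr 1
  funext y
  rw [avg_mul_left hψ]

theorem avg_sdiff_avg {R N : Finset (Fin n)} (hR : R ⊆ N) (φ : Cube n → ℝ) (x : Cube n) :
    avg (N \ R) (avg R φ) x = avg N φ x := by
  rw [← avg_union Finset.sdiff_disjoint, Finset.sdiff_union_of_subset hR]

theorem avg_mul_avg_self (N : Finset (Fin n)) (φ ψ : Cube n → ℝ) (x : Cube n) :
    avg N (fun y => φ y * avg N ψ y) x = avg N φ x * avg N ψ x := by
  have : (fun y => φ y * avg N ψ y) = fun y => avg N ψ y * φ y := by funext y; ring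
  rw [this, avg_mul_left (fun y i hi => avg_flip_mem hi ψ y)]
  ring

/-- The two families of averages of a cut are uncorrelated. -/
theorem avg_sections_mul {R N : Finset (Fin n)} (hR : R ⊆ N) (s : Cube n → ℝ) (x : Cube n) :
    avg N (fun y => avg (N \ R) s y * avg R s y) x = avg N s x ^ 2 := by
  rw [← avg_mul_avg (R := N \ R) Finset.sdiff_subset (fun y i hi => avg_flip_mem hi s y)]
  simp only [avg_sdiff_avg hR]
  rw [avg_mul_avg_self, avg_avg_of_subset Finset.sdiff_subset]
  ring

theorem avg_pos_of_eq_one (R : Finset (Fin n)) {s : Cube n → ℝ} (hs : ∀ y, 0 ≤ s y) {y : Cube n}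
    (hy : s y = 1) : 0 < avg R s y := by
  unfold avg
  refine div_pos (Finset.sum_pos' (fun T _ => hs _) ⟨∅, Finset.empty_mem_powerset R, ?_⟩)
    (by positivity)
  rw [flipSet_empty, hy]
  exact one_pos

theorem avg_negMulLog_avg {R N : Finset (Fin n)} (hR : R ⊆ N) (s : Cube n → ℝ) (x : Cube n) :
    avg N (fun y => Real.negMulLog (avg R s y)) x =
      avg N (fun y => s y * -Real.log (avg R s y)) x := by
  have h := avg_mul_avg hR (ψ := fun y => -Real.log (avg R s y))
    (fun y i hi => by simp only [avg_flip_mem hi]) s x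
  have e1 : (fun y => s y * -Real.log (avg R s y)) = fun y => -Real.log (avg R s y) * s y := by
    funext y; ring
  rw [e1, ← h]
  congr 1
  funext y
  rw [Real.negMulLog]
  ring

/-- Averaging over all translations in `R` replaces a translate by its conditional expectation. -/
theorem avg_sum_flipSet (R N : Finset (Fin n)) (φ ψ : Cube n → ℝ) (x : Cube n) :
    (∑ T ∈ R.powerset, avg N (fun y => ψ y * φ (flipSet T y)) x) / 2 ^ R.card =
      avg N (fun y => ψ y * avg R φ y) x := by
  rw [← avg_sum, div_eq_inv_mul, ← avg_const_mul]
  congr 1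
  funext y
  rw [avg, ← Finset.mul_sum]
  ring

/-- The right side is the mean of `-s log(ab/m)`, with `a`, `b` the two section measures and `m` the
total measure; then `log t ≤ t - 1`. By `avg_sections_mul` the left side is nonnegative, so a small
right side forces `ab` to have almost all of its mean on the set itself. -/
theorem avg_mul_sections_ge {s : Cube n → ℝ} (hs : ∀ y, s y = 0 ∨ s y = 1)
    {R N : Finset (Fin n)} (hR : R ⊆ N) (x : Cube n) (hm : 0 < avg N s x) :
    avg N s x - avg N (fun y => s y * (avg (N \ R) s y * avg R s y)) x / avg N s x ≤
      avg N (fun y => Real.negMulLog (avg R s y)) x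
      + avg N (fun y => Real.negMulLog (avg (N \ R) s y)) x - Real.negMulLog (avg N s x) := by
  have hs0 : ∀ y, 0 ≤ s y := fun y => by rcases hs y with h | h <;> simp [h]
  rw [avg_negMulLog_avg hR, avg_negMulLog_avg (R := N \ R) Finset.sdiff_subset]
  set m := avg N s x with hmdef
  have h : avg N (fun y => s y - m⁻¹ * (s y * (avg (N \ R) s y * avg R s y))) x ≤
      avg N (fun y => (s y * -Real.log (avg R s y) + s y * -Real.log (avg (N \ R) s y))
        + Real.log m * s y) x := by
    refine avg_mono N (fun y => ?_) x
    rcases hs y with h | h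
    · simp [h]
    · have h1 := avg_pos_of_eq_one R hs0 h
      have h2 := avg_pos_of_eq_one (N \ R) hs0 h
      have h3 := Real.log_le_sub_one_of_pos (x := m⁻¹ * (avg (N \ R) s y * avg R s y))
        (by positivity)
      rw [Real.log_mul (by positivity) (by positivity), Real.log_mul h2.ne' h1.ne',
        Real.log_inv] at h3
      rw [h]
      linarith
  rw [avg_sub, avg_add, avg_add, avg_const_mul, avg_const_mul] at h
  rw [Real.negMulLog, div_eq_inv_mul]
  linarith

theorem avg_flipSet (R T : Finset (Fin n)) (φ : Cube n → ℝ) (y : Cube n) :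
    avg R φ (flipSet T y) = avg R (fun z => φ (flipSet T z)) y := by
  induction T using Finset.induction_on generalizing y with
  | empty => simp [flipSet_empty]
  | insert i T hi ih =>
    simp only [flipSet_insert hi]
    rw [ih, ← avg_comp_flip]

/-- Compare each section with its translates by subsets of `N \ R`. If two sections have measures
`a`, `b` and overlap `o`, then `a b (a - b)² ≤ a (b - o) + b (a - o)`. Averaged over translations,
the left side gives the deficit in `(E a²)² ≤ E a · E a³`, and the right side gives the defect of
overlap. -/
theorem avg_cube_sub_sq_le {s : Cube n → ℝ} (hs : ∀ y, s y = 0 ∨ s y = 1)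
    {R N : Finset (Fin n)} (hR : R ⊆ N) (x : Cube n) :
    avg N s x * avg N (fun y => avg R s y ^ 3) x - avg N (fun y => avg R s y ^ 2) x ^ 2 ≤
      avg N s x ^ 2 - avg N (fun y => s y * (avg (N \ R) s y * avg R s y)) x := by
  have hs0 : ∀ y, 0 ≤ s y := fun y => by rcases hs y with h | h <;> simp [h]
  have hs1 : ∀ y, s y ≤ 1 := fun y => by rcases hs y with h | h <;> simp [h]
  have hinv : ∀ y, ∀ i ∈ R, avg R s (flip y i) = avg R s y := fun y i hi => avg_flip_mem hi s y
  -- the inequality for a single translation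
  have hT : ∀ T ∈ (N \ R).powerset,
      avg N (fun y => avg R s y ^ 3 * avg R s (flipSet T y)) x
        - avg N (fun y => avg R s y ^ 2 * avg R s (flipSet T y) ^ 2) x ≤
      avg N (fun y => avg R s y * avg R s (flipSet T y)) x
        - avg N (fun y => (s y * avg R s y) * s (flipSet T y)) x := by
    intro T hT
    have hTN : T ⊆ N := (Finset.mem_powerset.1 hT).trans Finset.sdiff_subset
    let o : Cube n → ℝ := fun y => avg R (fun z => s z * s (flipSet T z)) y
    have ho : ∀ y, o (flipSet T y) = o y := by
      intro y
      simp only [o, avg_flipSet, flipSet_flipSet]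
      congr 1
      funext z
      ring
    have hpt : avg N (fun y => avg R s y * avg R s (flipSet T y)
          * (avg R s y - avg R s (flipSet T y)) ^ 2) x ≤
        avg N (fun y => avg R s y * (avg R s (flipSet T y) - o y)
          + avg R s (flipSet T y) * (avg R s y - o y)) x := by
      refine avg_mono N (fun y => ?_) x
      have a0 := avg_nonneg R hs0 y
      have a1 := avg_le_one R hs1 y
      have b0 := avg_nonneg R hs0 (flipSet T y)
      have b1 := avg_le_one R hs1 (flipSet T y)
      have oa : o y ≤ avg R s y := avg_mono R (fun z => by
        have := hs0 z; have := hs1 (flipSet T z); nlinarith) y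
      have ob : o y ≤ avg R s (flipSet T y) := by
        rw [avg_flipSet]
        exact avg_mono R (fun z => by have := hs1 z; have := hs0 (flipSet T z); nlinarith) y
      set a := avg R s y
      set b := avg R s (flipSet T y)
      -- For `a ≤ b` the right side is at least `a (b - a)`, and the remaining factor `b (b - a)` is
      -- at most `1`.
      have key : ∀ a b : ℝ, 0 ≤ a → a ≤ b → b ≤ 1 → o y ≤ a →
          a * b * (a - b) ^ 2 ≤ a * (b - o y) + b * (a - o y) := by
        intro a b ha hab hb hoa
        have h1 : a * (b - a) ≤ a * (b - o y) + b * (a - o y) := by nlinarith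
        have h2 : b * (b - a) ≤ 1 := by nlinarith
        have h3 : 0 ≤ a * (b - a) := mul_nonneg ha (by linarith)
        have h4 : a * b * (a - b) ^ 2 = (a * (b - a)) * (b * (b - a)) := by ring
        rw [h4]
        nlinarith
      rcases le_total a b with h | h
      · exact key a b a0 h b1 oa
      · have := key b a b0 h a1 ob
        nlinarith
    have e1 : avg N (fun y => avg R s (flipSet T y) * (avg R s y - o y)) x =
        avg N (fun y => avg R s y * (avg R s (flipSet T y) - o y)) x := by
      rw [← avg_comp_flipSet hTN]
      simp only [flipSet_flipSet, ho]
    have e2 : avg N (fun y => avg R s (flipSet T y) ^ 3 * avg R s y) x =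
        avg N (fun y => avg R s y ^ 3 * avg R s (flipSet T y)) x := by
      rw [← avg_comp_flipSet hTN]
      simp only [flipSet_flipSet]
    have e3 : avg N (fun y => avg R s y * o y) x =
        avg N (fun y => (s y * avg R s y) * s (flipSet T y)) x := by
      rw [avg_mul_avg hR hinv]
      congr 1
      funext y
      ring
    have e4 : (fun y => avg R s y * avg R s (flipSet T y)
          * (avg R s y - avg R s (flipSet T y)) ^ 2) = fun y =>
        (avg R s y ^ 3 * avg R s (flipSet T y) + avg R s (flipSet T y) ^ 3 * avg R s y)
          - 2 * (avg R s y ^ 2 * avg R s (flipSet T y) ^ 2) := by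
      funext y; ring
    have e5 : avg N (fun y => avg R s y * (avg R s (flipSet T y) - o y)) x =
        avg N (fun y => avg R s y * avg R s (flipSet T y)) x - avg N (fun y => avg R s y * o y) x := by
      rw [← avg_sub]
      congr 1
      funext y
      ring
    rw [avg_add, e1, e4, avg_sub, avg_add, e2, avg_const_mul, e5, e3] at hpt
    linarith
  have hsum := Finset.sum_le_sum hT
  rw [Finset.sum_sub_distrib, Finset.sum_sub_distrib] at hsum
  have hdiv := div_le_div_of_nonneg_right hsum (by positivity : (0 : ℝ) ≤ 2 ^ (N \ R).card)
  rw [sub_div, sub_div, avg_sum_flipSet, avg_sum_flipSet, avg_sum_flipSet,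
    avg_sum_flipSet (N \ R) N (fun z => avg R s z ^ 2)] at hdiv
  have e6 : ∀ y, avg (N \ R) (fun z => avg R s z ^ 2) y = avg N (fun z => avg R s z ^ 2) y := by
    intro y
    rw [← avg_sdiff_avg hR]
    congr 1
    funext z
    exact (avg_of_invariant (ψ := fun z => avg R s z ^ 2)
      (fun y i hi => by rw [hinv y i hi]) z).symm
  have e7 : ∀ y, avg (N \ R) (fun z => avg R s z) y = avg N s y := fun y => avg_sdiff_avg hR s y
  simp only [e6, e7] at hdiv
  rw [avg_mul_avg_self, avg_mul_avg_self, avg_mul_avg_self] at hdiv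
  have e8 : avg N (fun y => avg R s y) x = avg N s x := avg_avg_of_subset hR s x
  have e9 : (fun y => s y * avg R s y * avg (N \ R) s y) =
      fun y => s y * (avg (N \ R) s y * avg R s y) := by
    funext y; ring
  rw [e8, e9] at hdiv
  linarith

/-- If both families of sections of a cut have almost minimal entropy, then the average of the
squared section measure is close to one of two values. -/
theorem avg_sq_dichotomy {s : Cube n → ℝ} (hs : ∀ y, s y = 0 ∨ s y = 1)
    {R N : Finset (Fin n)} (hR : R ⊆ N) (x : Cube n) (hm : 0 < avg N s x) {ξ : ℝ}
    (hξ : avg N (fun y => max (Real.negMulLog (avg R s y)) (Real.negMulLog (1 - avg R s y))) x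
      + avg N (fun y => Real.negMulLog (avg (N \ R) s y)) x ≤ Real.negMulLog (avg N s x) + ξ) :
    avg N s x ^ 2 - avg N s x * ξ ≤ avg N (fun y => s y * (avg (N \ R) s y * avg R s y)) x ∧
    (avg N (fun y => avg R s y ^ 2) x - avg N s x / 2) *
      (avg N s x - avg N (fun y => avg R s y ^ 2) x) ≤ 2 * avg N s x * ξ := by
  have hs0 : ∀ y, 0 ≤ s y := fun y => by rcases hs y with h | h <;> simp [h]
  have hs1 : ∀ y, s y ≤ 1 := fun y => by rcases hs y with h | h <;> simp [h]
  have h1 := avg_mul_sections_ge hs hR x hm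
  have h2 := avg_cube_sub_sq_le hs hR x
  have h3 := avg_sections_mul hR s x
  have h4 : avg N (fun y => Real.negMulLog (avg R s y) +
      avg R s y * (avg R s y - 1 / 2) * (1 - avg R s y)) x ≤
      avg N (fun y => max (Real.negMulLog (avg R s y)) (Real.negMulLog (1 - avg R s y))) x :=
    avg_mono N (fun y => negMulLog_add_le_max (avg_nonneg R hs0 y) (avg_le_one R hs1 y)) x
  have h5 : avg N (fun y => s y * (avg (N \ R) s y * avg R s y)) x ≤ avg N s x ^ 2 := by
    rw [← h3]
    refine avg_mono N (fun y => ?_) x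
    have := mul_nonneg (avg_nonneg (N \ R) hs0 y) (avg_nonneg R hs0 y)
    nlinarith [hs1 y]
  have e1 : (fun y => Real.negMulLog (avg R s y) +
      avg R s y * (avg R s y - 1 / 2) * (1 - avg R s y)) = fun y =>
      Real.negMulLog (avg R s y) + ((3 / 2 * avg R s y ^ 2 - 1 / 2 * avg R s y) - avg R s y ^ 3) := by
    funext y; ring
  have e2 : avg N (fun y => avg R s y) x = avg N s x := avg_avg_of_subset hR s x
  rw [e1, avg_add, avg_sub, avg_sub, avg_const_mul, avg_const_mul, e2] at h4
  have h6 : avg N (fun y => Real.negMulLog (avg R s y)) x ≤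
      avg N (fun y => max (Real.negMulLog (avg R s y)) (Real.negMulLog (1 - avg R s y))) x :=
    avg_mono N (fun y => le_max_left _ _) x
  set m := avg N s x
  set P := avg N (fun y => s y * (avg (N \ R) s y * avg R s y)) x
  set U := avg N (fun y => avg R s y ^ 2) x
  set C := avg N (fun y => avg R s y ^ 3) x
  have k1 : m - P / m ≤ ξ := by linarith
  have k2 : 0 ≤ m - P / m := by
    have : P / m ≤ m := by rw [div_le_iff₀ hm]; nlinarith
    linarith
  have k3 : 3 / 2 * U - 1 / 2 * m - C ≤ ξ := by linarith
  have k4 : m ^ 2 - m * ξ ≤ P := by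
    have : m * (m - P / m) ≤ m * ξ := by gcongr
    have e : m * (m - P / m) = m ^ 2 - P := by field_simp
    linarith
  refine ⟨k4, ?_⟩
  have k5 : m * (3 / 2 * U - 1 / 2 * m - C) ≤ m * ξ := by gcongr
  -- The product equals `(3/2) m U - m²/2 - U²`. Use `k5` for the cubic gain and `m C ≤ U² + m² - P
  -- ≤ U² + m ξ` from `h2` and `k4`.
  nlinarith

/-! ### Finding the half-cube -/

/-- If all cuts have almost minimal entropy, then the set almost lies in a half of the cube. -/
theorem exists_half_of_cuts {s : Cube n → ℝ} (hs : ∀ y, s y = 0 ∨ s y = 1)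
    (N : Finset (Fin n)) (x : Cube n) (hm : 0 < avg N s x) (hm1 : avg N s x < 3 / 4) {ξ : ℝ}
    (hξ : ∀ R ⊆ N,
      avg N (fun y => max (Real.negMulLog (avg R s y)) (Real.negMulLog (1 - avg R s y))) x
      + avg N (fun y => Real.negMulLog (avg (N \ R) s y)) x ≤ Real.negMulLog (avg N s x) + ξ) :
    ∃ i ∈ N, avg (N.erase i) s x * avg (N.erase i) s (flip x i) ≤ 82 * ξ := by
  have hs0 : ∀ y, 0 ≤ s y := fun y => by rcases hs y with h | h <;> simp [h]
  have hs1 : ∀ y, s y ≤ 1 := fun y => by rcases hs y with h | h <;> simp [h]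
  have hsq : ∀ y, s y ^ 2 = s y := fun y => by rcases hs y with h | h <;> simp [h]
  set m := avg N s x with hmdef
  let U : Finset (Fin n) → ℝ := fun R => avg N (fun y => avg R s y ^ 2) x
  have hU0 : U ∅ = m := by
    simp only [U, avg_empty, hsq]
    rfl
  have hUN : U N = m ^ 2 := by
    simp only [U]
    exact avg_of_invariant (fun y i hi => by rw [avg_flip_mem hi]) x
  -- `U` starts at `m` and ends at `m² < 3m/4`, so it crosses `3m/4`, the midpoint of the forbidden
  -- range `(m/2, m)`, when some coordinate `i` is added.
  obtain ⟨R, hRN, i, hiN, hiR, hR1, hR2⟩ : ∃ R ⊆ N, ∃ i ∈ N, i ∉ R ∧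
      3 / 4 * m ≤ U R ∧ U (insert i R) < 3 / 4 * m := by
    by_contra hcon
    push Not at hcon
    have : ∀ R ⊆ N, 3 / 4 * m ≤ U R := by
      intro R
      induction R using Finset.induction_on with
      | empty => intro _; rw [hU0]; linarith
      | insert i R hi ih =>
        intro hsub
        rw [Finset.insert_subset_iff] at hsub
        exact hcon R hsub.2 i hsub.1 hi (ih hsub.2)
    have := this N subset_rfl
    rw [hUN] at this
    nlinarith
  have hiRN : insert i R ⊆ N := Finset.insert_subset hiN hRN
  have hi1 : {i} ⊆ N := Finset.singleton_subset_iff.2 hiN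
  have d1 := (avg_sq_dichotomy hs hRN x hm (hξ R hRN)).2
  have d2 := (avg_sq_dichotomy hs hiRN x hm (hξ _ hiRN)).2
  have d3 := (avg_sq_dichotomy hs hi1 x hm (hξ _ hi1)).1
  replace d1 : (U R - m / 2) * (m - U R) ≤ 2 * m * ξ := d1
  replace d2 : (U (insert i R) - m / 2) * (m - U (insert i R)) ≤ 2 * m * ξ := d2
  replace d3 : m ^ 2 - m * ξ ≤ avg N (fun y => s y * (avg (N \ {i}) s y * avg {i} s y)) x := d3
  have hle : U R ≤ m := by
    have e : avg N (fun y => avg R s y) x = m := avg_avg_of_subset hRN s x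
    rw [← e]
    refine avg_mono N (fun y => ?_) x
    have := avg_nonneg R hs0 y
    have := avg_le_one R hs1 y
    nlinarith
  have hUR : m - U R ≤ 8 * ξ := by
    have h4 : m / 4 * (m - U R) ≤ 2 * m * ξ := by nlinarith
    have h5 : m * (m - U R) ≤ m * (8 * ξ) := by linarith
    exact le_of_mul_le_mul_left h5 hm
  have hξ0 : 0 ≤ ξ := by linarith
  have hUi : U (insert i R) - m / 2 ≤ 8 * ξ := by
    rcases le_total (U (insert i R)) (m / 2) with h | h
    · linarith
    · have h4 : (U (insert i R) - m / 2) * (m / 4) ≤ 2 * m * ξ := by nlinarith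
      have h5 : m * (U (insert i R) - m / 2) ≤ m * (8 * ξ) := by linarith
      exact le_of_mul_le_mul_left h5 hm
  have habs : avg N (fun y => |s y - avg R s y|) x = 2 * (m - U R) := by
    have e1 : (fun y => |s y - avg R s y|) = fun y => (s y + avg R s y) - 2 * (avg R s y * s y) := by
      funext y
      have h0 := avg_nonneg R hs0 y
      have h1 := avg_le_one R hs1 y
      rcases hs y with h | h
      · rw [h, zero_sub, abs_neg, abs_of_nonneg h0]; ring
      · rw [h, abs_of_nonneg (by linarith)]; ring
    have e2 : avg N (fun y => avg R s y) x = m := avg_avg_of_subset hRN s x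
    have e3 : avg N (fun y => avg R s y * s y) x = U R := by
      rw [← avg_mul_avg hRN (fun y i hi => avg_flip_mem hi s y)]
      simp only [U, sq]
    rw [e1, avg_sub, avg_add, avg_const_mul, e2, e3]
    ring
  -- Since `U R` is close to `m`, the function `s` is close in `L¹` to `avg R s`. Averaging out `R`
  -- before `i` therefore changes little, and the drop is due to `i` alone.
  have hUsingle : U {i} ≤ U (insert i R) + 2 * (2 * (m - U R)) := by
    have hpt : ∀ y, avg {i} s y ^ 2 ≤ avg (insert i R) s y ^ 2
        + 2 * avg {i} (fun z => |s z - avg R s z|) y := by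
      intro y
      have e1 : avg (insert i R) s y = avg {i} (avg R s) y := by
        rw [Finset.insert_eq, avg_union (by simpa using hiR)]
      have e2 : avg {i} s y - avg (insert i R) s y ≤ avg {i} (fun z => |s z - avg R s z|) y := by
        rw [e1, ← avg_sub]
        exact avg_mono _ (fun z => le_abs_self _) y
      have e3 := avg_nonneg {i} hs0 y
      have e4 := avg_le_one {i} hs1 y
      have e5 := avg_nonneg (insert i R) hs0 y
      have e6 := avg_le_one (insert i R) hs1 y
      have e7 : 0 ≤ avg {i} (fun z => |s z - avg R s z|) y := avg_nonneg _ (fun z => abs_nonneg _) y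
      nlinarith
    have := avg_mono N hpt x
    rw [avg_add, avg_const_mul] at this
    have e8 : avg N (fun y => avg {i} (fun z => |s z - avg R s z|) y) x =
        avg N (fun z => |s z - avg R s z|) x := avg_avg_of_subset hi1 _ x
    rw [e8, habs] at this
    exact this
  have hsing : ∀ y, avg {i} s y = (s y + s (flip y i)) / 2 := by
    intro y
    have : ({i} : Finset (Fin n)) = insert i ∅ := rfl
    rw [this, avg_insert (Finset.notMem_empty i), avg_empty, avg_empty]
  have hshift : avg N (fun y => s (flip y i)) x = m := avg_comp_flip_mem hiN s x
  -- The constant is `80 = 2 (8 + 4 · 8)`: `hUi` gives `8 ξ` and `hUR`, used in `hUsingle`, gives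
  -- `32 ξ`.
  have hcorr : avg N (fun y => s y * s (flip y i)) x ≤ 80 * ξ := by
    have e1 : U {i} = m / 2 + avg N (fun y => s y * s (flip y i)) x / 2 := by
      have : (fun y => avg {i} s y ^ 2) = fun y =>
          (1 / 4 * s y + 1 / 4 * s (flip y i)) + 1 / 2 * (s y * s (flip y i)) := by
        funext y
        rw [hsing]
        have h1 := hsq y
        have h2 := hsq (flip y i)
        linear_combination 1 / 4 * h1 + 1 / 4 * h2
      simp only [U, this]
      rw [avg_add, avg_add, avg_const_mul, avg_const_mul, avg_const_mul, hshift]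
      ring
    linarith
  refine ⟨i, hiN, ?_⟩
  set p := avg (N.erase i) s x
  set q := avg (N.erase i) s (flip x i)
  have hsd : N \ {i} = N.erase i := Finset.sdiff_singleton_eq_erase i N
  have hmpq : m = (p + q) / 2 := by
    rw [hmdef, ← avg_insert (Finset.notMem_erase i N), Finset.insert_erase hiN]
  have hsM : avg N (fun y => s y * avg (N.erase i) s y) x = (p ^ 2 + q ^ 2) / 2 := by
    have e1 : (fun y => s y * avg (N.erase i) s y) = fun y => avg (N.erase i) s y * s y := by
      funext y; ring
    rw [e1, ← avg_mul_avg (Finset.erase_subset i N) (fun y j hj => avg_flip_mem hj s y)]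
    have hinv : ∀ y, ∀ j ∈ N.erase i, avg (N.erase i) s (flip y j) * avg (N.erase i) s (flip y j) =
        avg (N.erase i) s y * avg (N.erase i) s y := fun y j hj => by rw [avg_flip_mem hj]
    have : avg N (fun y => avg (N.erase i) s y * avg (N.erase i) s y) x =
        avg (insert i (N.erase i)) (fun y => avg (N.erase i) s y * avg (N.erase i) s y) x := by
      rw [Finset.insert_erase hiN]
    rw [this, avg_insert (Finset.notMem_erase i N), avg_of_invariant (ψ := fun y => avg (N.erase i) s y * avg (N.erase i) s y) hinv,
      avg_of_invariant (ψ := fun y => avg (N.erase i) s y * avg (N.erase i) s y) hinv]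
    ring
  have hP : avg N (fun y => s y * (avg (N \ {i}) s y * avg {i} s y)) x ≤
      1 / 2 * ((p ^ 2 + q ^ 2) / 2) + 1 / 2 * avg N (fun y => s y * s (flip y i)) x := by
    rw [← hsM, ← avg_const_mul, ← avg_const_mul, ← avg_add]
    refine avg_mono N (fun y => ?_) x
    rw [hsd, hsing]
    have h1 := avg_le_one (N.erase i) hs1 y
    rcases hs y with h | h
    · simp [h]
    · rw [h]
      have := hs0 (flip y i)
      nlinarith
  have hξm : m * ξ ≤ ξ := by nlinarith
  have h4 : m ^ 2 = (p ^ 2 + q ^ 2) / 4 + p * q / 2 := by rw [hmpq]; ring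
  -- In `m²` the cross term is `p q / 2`. Comparing `d3` with `hP` bounds it by `40 ξ + m ξ ≤ 41 ξ`.
  linarith

/-! ### Qualitative stability by induction on the codimension -/

/-- The subcube of all vertices agreeing with `z` on `I`. -/
def subcube (I : Finset (Fin n)) (z : Cube n) : Finset (Cube n) :=
  Finset.univ.filter fun x => ∀ i ∈ I, x i = z i

theorem avg_congr_of_subset {R : Finset (Fin n)} {φ ψ : Cube n → ℝ} {x : Cube n}
    (h : ∀ T ⊆ R, φ (flipSet T x) = ψ (flipSet T x)) : avg R φ x = avg R ψ x := by
  unfold avg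
  congr 1
  exact Finset.sum_congr rfl fun T hT => h T (Finset.mem_powerset.1 hT)

theorem flipSet_apply_of_notMem {T : Finset (Fin n)} {i : Fin n} (hi : i ∉ T) (x : Cube n) :
    flipSet T x i = x i := by simp [flipSet, hi]

theorem avg_eq_half_add {N : Finset (Fin n)} {i : Fin n} (hi : i ∈ N) (φ : Cube n → ℝ)
    (x : Cube n) : avg N φ x = (avg (N.erase i) φ x + avg (N.erase i) φ (flip x i)) / 2 := by
  rw [← avg_insert (Finset.notMem_erase i N), Finset.insert_erase hi]

theorem negMulLog_half_pow (k : ℕ) :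
    Real.negMulLog ((1 / 2 : ℝ) ^ k) = Real.log 2 * (k * (1 / 2 : ℝ) ^ k) := by
  rw [Real.negMulLog, Real.log_pow, one_div, Real.log_inv]
  ring

theorem edgeDensity_nonneg (R : Finset (Fin n)) (A B : Finset (Cube n)) (x : Cube n) :
    0 ≤ edgeDensity R A B x :=
  avg_nonneg R (fun y => mul_nonneg (ind_nonneg A y)
    (Finset.sum_nonneg fun _ _ => ind_nonneg B _)) x

/-- Passing to the half of the cube which contains almost all of `A`. -/
theorem half_estimates {A B W : Finset (Cube n)} (h : IsPartition A B W) {N : Finset (Fin n)}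
    {i : Fin n} (hi : i ∈ N) (x : Cube n) {q : ℝ}
    (hq : avg (N.erase i) (fun y => 1 - ind B y) (flip x i) ≤ q) :
    |avg (N.erase i) (ind A) x - 2 * avg N (ind A) x| ≤ q ∧
    edgeDensity (N.erase i) A B x ≤
      2 * (edgeDensity N A B x - avg N (ind A) x + q) := by
  have hA1 : ∀ y, ind A y ≤ 1 - ind B y := fun y => by
    have := h.ind_add y; have := ind_nonneg W y; linarith
  have hsum := avg_eq_half_add hi (ind A) x
  have hAq := (avg_mono (N.erase i) hA1 (flip x i)).trans hq
  have hA0 := avg_nonneg (N.erase i) (ind_nonneg A) (flip x i)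
  refine ⟨abs_le.2 ⟨by linarith, by linarith⟩, ?_⟩
  have e0 : edgeDensity N A B x = avg N (fun y => ind A y * ∑ j ∈ N.erase i, ind B (flip y j)) x
      + avg N (fun y => ind A y * ind B (flip y i)) x := by
    unfold edgeDensity
    rw [← avg_add]
    congr 1
    funext y
    rw [← Finset.add_sum_erase N _ hi]
    ring
  have e1 : avg N (fun y => ind A y * ∑ j ∈ N.erase i, ind B (flip y j)) x =
      (edgeDensity (N.erase i) A B x + edgeDensity (N.erase i) A B (flip x i)) / 2 :=
    avg_eq_half_add hi _ x
  have e2 := edgeDensity_nonneg (N.erase i) A B (flip x i)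
  have e3 : avg N (ind A) x - avg N (fun y => ind A y * (1 - ind B (flip y i))) x =
      avg N (fun y => ind A y * ind B (flip y i)) x := by
    rw [← avg_sub]
    congr 1
    funext y
    ring
  have hle : ∀ y, ind A y * (1 - ind B (flip y i)) ≤ 1 - ind B (flip y i) := fun y => by
    have := ind_le_one A y; have := ind_le_one B (flip y i); nlinarith
  have hle' : ∀ y, ind A y * (1 - ind B (flip y i)) ≤ 1 - ind B y := fun y => by
    have := hA1 y; have := ind_nonneg A y; have := ind_nonneg B (flip y i); nlinarith
  -- A vertex of `A` whose `i`-neighbour is not in `B` either lies in the sparse half or has its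
  -- neighbour there. Hence the direction `i` carries almost `avg N (ind A) x` edges, which the
  -- half-cube no longer pays for.
  have e4 : avg N (fun y => ind A y * (1 - ind B (flip y i))) x ≤ q := by
    rw [avg_eq_half_add hi]
    have k1 := (avg_mono (N.erase i) hle x)
    rw [avg_comp_flip (N.erase i) (fun y => 1 - ind B y)] at k1
    have k2 := avg_mono (N.erase i) hle' (flip x i)
    linarith
  linarith

theorem avg_abs_sub_subcube {A B W : Finset (Cube n)} (h : IsPartition A B W)
    {N : Finset (Fin n)} {i : Fin n} (hi : i ∈ N) (x : Cube n) {q δ : ℝ}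
    (hq : avg (N.erase i) (fun y => 1 - ind B y) (flip x i) ≤ q) {I : Finset (Fin n)}
    (hI : I ⊆ N.erase i) {z : Cube n}
    (hz : avg (N.erase i) (fun y => |ind A y - ind (subcube I z) y|) x ≤ δ) :
    avg N (fun y => |ind A y - ind (subcube (insert i I) (Function.update z i (x i))) y|) x
      ≤ (δ + q) / 2 := by
  have hiI : i ∉ I := fun hc => Finset.notMem_erase i N (hI hc)
  have hmem : ∀ y, y ∈ subcube (insert i I) (Function.update z i (x i)) ↔
      y i = x i ∧ y ∈ subcube I z := by
    intro y
    simp only [subcube, Finset.mem_filter, Finset.mem_univ, true_and, Finset.forall_mem_insert,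
      Function.update_self]
    refine and_congr_right fun _ => forall₂_congr fun j hj => ?_
    rw [Function.update_of_ne (ne_of_mem_of_not_mem hj hiI)]
  rw [avg_eq_half_add hi]
  have e1 : avg (N.erase i)
      (fun y => |ind A y - ind (subcube (insert i I) (Function.update z i (x i))) y|) x =
      avg (N.erase i) (fun y => |ind A y - ind (subcube I z) y|) x := by
    refine avg_congr_of_subset fun T hT => ?_
    have : flipSet T x i = x i :=
      flipSet_apply_of_notMem (fun hc => Finset.notMem_erase i N (hT hc)) x
    simp only [ind, hmem, this, true_and]
  have e2 : avg (N.erase i)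
      (fun y => |ind A y - ind (subcube (insert i I) (Function.update z i (x i))) y|) (flip x i) =
      avg (N.erase i) (ind A) (flip x i) := by
    refine avg_congr_of_subset fun T hT => ?_
    have : flipSet T (flip x i) i = !x i := by
      rw [flipSet_apply_of_notMem (fun hc => Finset.notMem_erase i N (hT hc)), flip_apply, if_pos rfl]
    have hne : ¬ ((!x i) = x i) := by simp
    have h0 : ind (subcube (insert i I) (Function.update z i (x i))) (flipSet T (flip x i)) = 0 := by
      simp only [ind, hmem, this, hne, false_and, if_false]
    simp only [h0, sub_zero, abs_of_nonneg (ind_nonneg _ _)]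
  have hA1 : ∀ y, ind A y ≤ 1 - ind B y := fun y => by
    have := h.ind_add y; have := ind_nonneg W y; linarith
  have e3 := (avg_mono (N.erase i) hA1 (flip x i)).trans hq
  rw [e1, e2]
  linarith

/-- Qualitative stability for the edge-isoperimetric problem with a small exceptional set. -/
theorem exists_subcube_close (k : ℕ) : ∀ δ : ℝ, 0 < δ → ∃ η : ℝ, 0 < η ∧
    ∀ (n : ℕ) (N : Finset (Fin n)) (x : Cube n) (A B W : Finset (Cube n)), IsPartition A B W →
      |avg N (ind A) x - (1 / 2 : ℝ) ^ k| ≤ η →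
      edgeDensity N A B x ≤ k * (1 / 2 : ℝ) ^ k + η →
      √((n : ℝ) + 1) * avg N (ind W) x ≤ η →
      ∃ I ⊆ N, I.card = k ∧ ∃ z : Cube n,
        avg N (fun y => |ind A y - ind (subcube I z) y|) x ≤ δ := by
  induction k with
  | zero =>
    intro δ hδ
    refine ⟨δ, hδ, fun n N x A B W _ hA _ _ => ⟨∅, Finset.empty_subset N, rfl, x, ?_⟩⟩
    have e : ∀ y, |ind A y - ind (subcube ∅ x) y| = 1 - ind A y := by
      intro y
      have : ind (subcube ∅ x) y = 1 := by simp [ind, subcube]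
      rw [this, abs_of_nonpos (by linarith [ind_le_one A y])]
      ring
    simp only [e]
    rw [avg_sub, avg_const]
    have := abs_le.1 hA
    simp only [pow_zero] at this
    linarith
  | succ k ih =>
    intro δ hδ
    obtain ⟨η', hη', IH⟩ := ih δ hδ
    set P : ℝ := (1 / 2 : ℝ) ^ (k + 1) with hP
    have hP0 : 0 < P := by positivity
    have hP1 : P ≤ 1 / 2 := by
      rw [hP, pow_succ]
      have : (1 / 2 : ℝ) ^ k ≤ 1 := pow_le_one₀ (by norm_num) (by norm_num)
      linarith
    set κ := min δ (η' / 4) with hκ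
    have hκ0 : 0 < κ := lt_min hδ (by linarith)
    -- Chosen so that `82 ξ = κ P / 2`: as the denser half has density at least `P / 2`, the other
    -- has density at most `κ`.
    set ξ := κ * P / 164 with hξ
    have hξ0 : 0 < ξ := by positivity
    obtain ⟨τ, hτ0, hτ⟩ := Metric.continuousAt_iff.1
      (Real.continuous_negMulLog.continuousAt (x := P)) (ξ / 4) (by linarith)
    set X := max 1 (24 / ξ) with hX
    have hX1 : 1 ≤ X := le_max_left _ _
    have hX6 : 6 / X ≤ ξ / 4 := by
      have : 24 / ξ ≤ X := le_max_right _ _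
      rw [div_le_iff₀ hξ0] at this
      rw [div_le_iff₀ (by linarith)]
      linarith
    have hden : 0 < 4 * √X + 1 := by positivity
    -- The budget `ξ` is split into quarters: the excess of edges, the term `6 / X`, the
    -- contribution of `W`, and the continuity of `negMulLog` at `P`.
    set η := min (min (P / 8) (τ / 4)) (min (η' / 16) (ξ / 4 / (4 * √X + 1))) with hη
    have hη0 : 0 < η := by
      refine lt_min (lt_min (by linarith) (by linarith)) (lt_min (by linarith) ?_)
      positivity
    have hηP : η ≤ P / 8 := (min_le_left _ _).trans (min_le_left _ _)
    have hητ : η ≤ τ / 4 := (min_le_left _ _).trans (min_le_right _ _)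
    have hηη' : η ≤ η' / 16 := (min_le_right _ _).trans (min_le_left _ _)
    have hηX : (4 * √X + 1) * η ≤ ξ / 4 := by
      have : η ≤ ξ / 4 / (4 * √X + 1) := (min_le_right _ _).trans (min_le_right _ _)
      rw [le_div_iff₀ hden] at this
      linarith
    refine ⟨η, hη0, fun n N x A B W hpart hA hE hW => ?_⟩
    have hA' := abs_le.1 hA
    have hw0 := avg_nonneg N (ind_nonneg W) x
    have hs1 : 1 ≤ √((n : ℝ) + 1) := Real.one_le_sqrt.2 (by linarith [n.cast_nonneg (α := ℝ)])
    have hwη : avg N (ind W) x ≤ η := by nlinarith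
    have hm : avg N (fun y => 1 - ind B y) x = avg N (ind A) x + avg N (ind W) x := by
      rw [avg_one_sub_ind]; linarith [hpart.avg_add N x]
    have hcut : ∀ R ⊆ N, avg N (fun y => max (Real.negMulLog (avg R (fun z => 1 - ind B z) y))
        (Real.negMulLog (1 - avg R (fun z => 1 - ind B z) y))) x
        + avg N (fun y => Real.negMulLog (avg (N \ R) (fun z => 1 - ind B z) y)) x ≤
        Real.negMulLog (avg N (fun z => 1 - ind B z) x) + ξ := by
      intro R hR
      refine (section_entropy_le hpart hX1 hR x).trans ?_
      have h1 : (4 * √X * √n + 1) * avg N (ind W) x ≤ ξ / 4 := by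
        have hn : √(n : ℝ) ≤ √((n : ℝ) + 1) := Real.sqrt_le_sqrt (by linarith)
        calc (4 * √X * √n + 1) * avg N (ind W) x
            ≤ (4 * √X * √((n : ℝ) + 1) + √((n : ℝ) + 1)) * avg N (ind W) x := by gcongr
          _ = (4 * √X + 1) * (√((n : ℝ) + 1) * avg N (ind W) x) := by ring
          _ ≤ (4 * √X + 1) * η := by gcongr
          _ ≤ _ := hηX
      have hl2 : Real.log 2 ≤ 1 := by have := Real.log_two_lt_d9; linarith
      have hl : 0 < Real.log 2 := Real.log_pos (by norm_num)
      have h2 : Real.log 2 * edgeDensity N A B x ≤ Real.negMulLog P + ξ / 4 := by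
        rw [hP, negMulLog_half_pow, ← hP]
        have hηξ : η ≤ ξ / 4 := by
          have : 0 ≤ √X := Real.sqrt_nonneg _
          nlinarith
        calc Real.log 2 * edgeDensity N A B x
            ≤ Real.log 2 * (((k + 1 : ℕ) : ℝ) * P + η) := by gcongr
          _ = Real.log 2 * (((k + 1 : ℕ) : ℝ) * P) + Real.log 2 * η := by ring
          _ ≤ _ := by
            have : Real.log 2 * η ≤ 1 * η := by gcongr
            linarith
      have h3 : |Real.negMulLog (avg N (fun z => 1 - ind B z) x) - Real.negMulLog P| < ξ / 4 := by
        rw [← Real.dist_eq]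
        refine hτ ?_
        rw [Real.dist_eq, hm, abs_lt]
        constructor <;> linarith
      have := (abs_lt.1 h3).1
      linarith
    have hmP : P / 2 ≤ avg N (fun z => 1 - ind B z) x := by rw [hm]; linarith
    obtain ⟨i, hi, hpq⟩ := exists_half_of_cuts (one_sub_ind B) N x (by linarith)
      (by rw [hm]; linarith) hcut
    -- it suffices to treat the case where the second half is almost empty
    have main : ∀ x, |avg N (ind A) x - P| ≤ η →
        edgeDensity N A B x ≤ ((k + 1 : ℕ) : ℝ) * P + η → √((n : ℝ) + 1) * avg N (ind W) x ≤ η →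
        avg (N.erase i) (fun y => 1 - ind B y) (flip x i) ≤ κ →
        ∃ I ⊆ N, I.card = k + 1 ∧ ∃ z : Cube n,
        avg N (fun y => |ind A y - ind (subcube I z) y|) x ≤ δ := by
      intro x hA hE hW hq
      have hA' := abs_le.1 hA
      obtain ⟨g1, g2⟩ := half_estimates hpart hi x hq
      have g1' := abs_le.1 g1
      have hκ4 : κ ≤ η' / 4 := min_le_right _ _
      have hκδ : κ ≤ δ := min_le_left _ _
      have hPk : (1 / 2 : ℝ) ^ k = 2 * P := by rw [hP, pow_succ]; ring
      have hWhalf : avg (N.erase i) (ind W) x ≤ 2 * avg N (ind W) x := by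
        have := avg_eq_half_add hi (ind W) x
        have := avg_nonneg (N.erase i) (ind_nonneg W) (flip x i)
        linarith
      obtain ⟨I, hI, hIk, z, hz⟩ := IH n (N.erase i) x A B W hpart
        (by rw [hPk]; exact abs_le.2 ⟨by linarith, by linarith⟩)
        (by rw [hPk]; push_cast at hE; linarith)
        (by
          calc √((n : ℝ) + 1) * avg (N.erase i) (ind W) x
              ≤ √((n : ℝ) + 1) * (2 * avg N (ind W) x) := by gcongr
            _ ≤ η' := by linarith)
      refine ⟨insert i I, Finset.insert_subset hi (hI.trans (Finset.erase_subset i N)), ?_,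
        Function.update z i (x i), ?_⟩
      · rw [Finset.card_insert_of_notMem (fun hc => Finset.notMem_erase i N (hI hc)), hIk]
      · exact (avg_abs_sub_subcube hpart hi x hq hI hz).trans (by linarith)
    have hsum := avg_eq_half_add hi (fun y => 1 - ind B y) x
    have hsmall : ∀ p q : ℝ, p * q ≤ 82 * ξ → P / 2 ≤ p → 0 ≤ q → q ≤ κ := by
      intro p q h1 h2 h3
      have h4 : P * q ≤ P * κ := by
        have : P / 2 * q ≤ p * q := by gcongr
        have e : 82 * ξ = P * κ / 2 := by rw [hξ]; ring
        linarith
      exact le_of_mul_le_mul_left h4 hP0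
    have hs0 : ∀ y, 0 ≤ 1 - ind B y := fun y => by linarith [ind_le_one B y]
    -- The product bound is symmetric in the halves, so the base point is moved into the denser one.
    rcases le_total (avg (N.erase i) (fun y => 1 - ind B y) (flip x i))
      (avg (N.erase i) (fun y => 1 - ind B y) x) with hle | hle
    · exact main x hA hE hW (hsmall _ _ hpq (by linarith) (avg_nonneg _ hs0 _))
    · have hinv : ∀ φ, avg N φ (flip x i) = avg N φ x := fun φ => avg_flip_mem hi φ x
      have := main (flip x i) (by rwa [hinv]) (by unfold edgeDensity; rw [hinv]; exact hE)
        (by rwa [hinv])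
        (by
          rw [flip_flip]
          exact hsmall _ _ (by rwa [mul_comm]) (by linarith) (avg_nonneg _ hs0 _))
      simpa only [hinv] using this

/-! ### From closeness to linear closeness -/

theorem mem_subcube {I : Finset (Fin n)} {z x : Cube n} :
    x ∈ subcube I z ↔ ∀ i ∈ I, x i = z i := by simp [subcube]

theorem ind_subcube_flip {I : Finset (Fin n)} {i : Fin n} (hi : i ∉ I) (z x : Cube n) :
    ind (subcube I z) (flip x i) = ind (subcube I z) x := by
  have : flip x i ∈ subcube I z ↔ x ∈ subcube I z := by
    simp only [mem_subcube]
    refine forall₂_congr fun j hj => ?_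
    rw [flip_apply, if_neg (ne_of_mem_of_not_mem hj hi)]
  simp only [ind, this]

theorem ind_subcube_add_flip_le {I : Finset (Fin n)} {i : Fin n} (hi : i ∈ I) (z x : Cube n) :
    ind (subcube I z) x + ind (subcube I z) (flip x i) ≤ 1 := by
  by_cases h : x ∈ subcube I z
  · have : flip x i ∉ subcube I z := by
      intro h'
      have h1 := mem_subcube.1 h i hi
      have h2 := mem_subcube.1 h' i hi
      rw [flip_apply, if_pos rfl, h1] at h2
      simp at h2
    simp [ind, h, this]
  · have : ind (subcube I z) x = 0 := by simp [ind, h]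
    rw [this, zero_add]
    exact ind_le_one _ _

/-- Averages over a subcube as averages over the whole cube. -/
theorem avg_univ_ind_subcube_mul (I : Finset (Fin n)) (z : Cube n) (φ : Cube n → ℝ) :
    avg Finset.univ (fun y => ind (subcube I z) y * φ y) z = (1 / 2) ^ I.card * avg Iᶜ φ z := by
  have e1 : (Finset.univ : Finset (Fin n)) = I ∪ Iᶜ := by simp
  rw [e1, avg_union disjoint_compl_right]
  have e2 : avg Iᶜ (fun y => ind (subcube I z) y * φ y) =
      fun y => ind (subcube I z) y * avg Iᶜ φ y := by
    funext y
    exact avg_mul_left (fun x i hi => ind_subcube_flip (Finset.mem_compl.1 hi) z x) φ y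
  rw [e2, avg, Finset.sum_eq_single ∅]
  · have : ind (subcube I z) z = 1 := by simp [ind, mem_subcube]
    rw [flipSet_empty, this, one_mul, one_div, inv_pow, div_eq_inv_mul]
  · intro T hT hne
    obtain ⟨i, hi⟩ := Finset.nonempty_iff_ne_empty.2 hne
    have : flipSet T z ∉ subcube I z := by
      intro hc
      have := mem_subcube.1 hc i (Finset.mem_powerset.1 hT hi)
      simp [flipSet, hi] at this
    simp [ind, this]
  · intro hc
    exact absurd (Finset.empty_mem_powerset I) hc

theorem avg_univ_ind_subcube (I : Finset (Fin n)) (z x : Cube n) :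
    avg Finset.univ (ind (subcube I z)) x = (1 / 2) ^ I.card := by
  have h := avg_univ_ind_subcube_mul I z (fun _ => 1)
  simp only [mul_one, avg_const] at h
  rw [← h, avg_univ, avg_univ]

/-- For such small `b`, `log₂(1/b) ≥ (k+2)²`, so the root in the profile is at least `k + 2`. -/
theorem profile_one_ge {b : ℝ} (hb : 0 ≤ b) {k : ℕ} (hbk : b ≤ (1 / 2) ^ ((k + 2) ^ 2)) :
    (k + 1) * b ≤ profile 1 b - b := by
  rcases hb.eq_or_lt with h | h
  · rw [← h]; simp [profile]
  have hl : 0 < Real.log 2 := Real.log_pos (by norm_num)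
  have h1 : Real.log b ≤ -((k + 2) ^ 2 * Real.log 2) := by
    have := Real.log_le_log h hbk
    rw [Real.log_pow, one_div, Real.log_inv] at this
    push_cast at this
    linarith
  have h2 : (k + 2 : ℝ) ≤ √(1 - Real.log b / Real.log 2) := by
    refine Real.le_sqrt_of_sq_le ?_
    have : Real.log b / Real.log 2 ≤ -(k + 2 : ℝ) ^ 2 := by
      rw [div_le_iff₀ hl]; linarith
    linarith
  rw [profile]
  nlinarith

/-- Pointwise count for one edge leaving the subcube: it fails to run from `A` to `B` only if its
inner end is in `B`, an end is in `W`, or its outer end belongs to `A` outside the subcube. Letters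
are the indicator values at the two ends. -/
theorem crossing_bound {a b w a' b' w' c c' : ℝ} (h : a + b + w = 1) (h' : a' + b' + w' = 1)
    (hcc : c + c' ≤ 1) (hc0 : 0 ≤ c) (hc1 : c ≤ 1) (ha0 : 0 ≤ a) (ha1 : a ≤ 1) (hw0 : 0 ≤ w)
    (ha'0 : 0 ≤ a') (hb'0 : 0 ≤ b') (hb'1 : b' ≤ 1) (hw'0 : 0 ≤ w') :
    ((c - c * b) - (w + w')) - (1 - c') * a' ≤ a * b' := by
  have t1 : c * (a + b' - 1) ≤ c * (a * b') := by
    have := mul_nonneg (sub_nonneg.2 ha1) (sub_nonneg.2 hb'1)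
    gcongr
    linarith
  have t2 : c * (a * b') ≤ a * b' := mul_le_of_le_one_left (mul_nonneg ha0 hb'0) hc1
  have t3 : c * w ≤ w := mul_le_of_le_one_left hw0 hc1
  have t4 : c * w' ≤ w' := mul_le_of_le_one_left hw'0 hc1
  have t5 : c * a' ≤ (1 - c') * a' := by gcongr; linarith
  have e : c * (a + b' - 1) = c - c * b - c * w - c * a' - c * w' := by
    rw [show a = 1 - b - w by linarith, show b' = 1 - a' - w' by linarith]; ring
  linarith

/-- A set which is roughly a subcube and has almost minimal edge boundary is linearly close to
the subcube. -/
theorem avg_abs_sub_subcube_le {A B W : Finset (Cube n)} (h : IsPartition A B W) {k : ℕ}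
    {I : Finset (Fin n)} (hI : I.card = k) (z : Cube n) {ε D : ℝ} (hε : 0 ≤ ε)
    (hA : avg Finset.univ (ind A) z - (1 / 2 : ℝ) ^ k ≤ ε * (1 / 2 : ℝ) ^ k)
    (hW : √((n : ℝ) + 1) * avg Finset.univ (ind W) z ≤ D * ε)
    (hE : edgeDensity Finset.univ A B z ≤ (1 + ε) * (k * (1 / 2 : ℝ) ^ k))
    (hclose : avg Finset.univ (fun y => |ind A y - ind (subcube I z) y|) z ≤
      (1 / 2) ^ k * (1 / 2) ^ ((k + 2) ^ 2)) :
    avg Finset.univ (fun y => |ind A y - ind (subcube I z) y|) z ≤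
      (2 * k + (3 * k + 4) * D + 1) * ε := by
  set c := ind (subcube I z) with hc
  have hc0 : ∀ y, 0 ≤ c y := ind_nonneg _
  have hc1 : ∀ y, c y ≤ 1 := ind_le_one _
  have hEc : avg Finset.univ c z = (1 / 2 : ℝ) ^ k := by rw [hc, avg_univ_ind_subcube, hI]
  have hPk0 : (0 : ℝ) < (1 / 2) ^ k := by positivity
  have hPk1 : (1 / 2 : ℝ) ^ k ≤ 1 := pow_le_one₀ (by norm_num) (by norm_num)
  set β := avg Finset.univ (fun y => c y * ind B y) z with hβ
  set ω := avg Finset.univ (ind W) z with hω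
  set γ := avg Finset.univ (fun y => c y * ind W y) z with hγ
  set ζ := avg Finset.univ (fun y => (1 - c y) * ind A y) z with hζ
  have hω0 : 0 ≤ ω := avg_nonneg _ (ind_nonneg W) z
  have hγ0 : 0 ≤ γ := avg_nonneg _ (fun y => mul_nonneg (hc0 y) (ind_nonneg W y)) z
  have hβ0 : 0 ≤ β := avg_nonneg _ (fun y => mul_nonneg (hc0 y) (ind_nonneg B y)) z
  have hγω : γ ≤ ω := avg_mono _ (fun y => by
    have := hc1 y; have := ind_nonneg W y; nlinarith) z
  have hs1 : 1 ≤ √((n : ℝ) + 1) := Real.one_le_sqrt.2 (by linarith [n.cast_nonneg (α := ℝ)])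
  have hωD : ω ≤ D * ε := by nlinarith
  have hnD : √n * ω ≤ D * ε := by
    have : √(n : ℝ) ≤ √((n : ℝ) + 1) := Real.sqrt_le_sqrt (by linarith)
    nlinarith
  have habs : avg Finset.univ (fun y => |ind A y - c y|) z = β + γ + ζ := by
    rw [hβ, hγ, hζ, ← avg_add, ← avg_add]
    congr 1
    funext y
    have hp := h.ind_add y
    rcases ind_eq_zero_or_one A y with h1 | h1 <;>
      rcases ind_eq_zero_or_one (subcube I z) y with h2 | h2 <;>
      rw [← hc] at h2 <;> rw [h1, h2] <;> norm_num <;> linarith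
  have hζβ : ζ = avg Finset.univ (ind A) z - (1 / 2 : ℝ) ^ k + β + γ := by
    rw [hβ, hγ, hζ, ← hEc, ← avg_sub, ← avg_add, ← avg_add]
    congr 1
    funext y
    have hp := h.ind_add y
    linear_combination (-c y) * hp
  -- edges across the boundary of the subcube
  have hcross : ∀ i ∈ I, (1 / 2 : ℝ) ^ k - β - 2 * ω - ζ ≤
      avg Finset.univ (fun y => ind A y * ind B (flip y i)) z := by
    intro i hi
    have e1 : avg Finset.univ (fun y => ind W (flip y i)) z = ω :=
      avg_comp_flip_mem (Finset.mem_univ i) (ind W) z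
    have e2 : avg Finset.univ (fun y => (1 - c (flip y i)) * ind A (flip y i)) z = ζ :=
      avg_comp_flip_mem (Finset.mem_univ i) (fun y => (1 - c y) * ind A y) z
    have e3 : avg Finset.univ (fun y => ((c y - c y * ind B y) - (ind W y + ind W (flip y i))) -
        (1 - c (flip y i)) * ind A (flip y i)) z ≤
        avg Finset.univ (fun y => ind A y * ind B (flip y i)) z := by
      refine avg_mono _ (fun y => ?_) z
      exact crossing_bound (h.ind_add y) (h.ind_add (flip y i)) (ind_subcube_add_flip_le hi z y)
        (hc0 y) (hc1 y) (ind_nonneg _ _) (ind_le_one _ _) (ind_nonneg _ _) (ind_nonneg _ _)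
        (ind_nonneg _ _) (ind_le_one _ _) (ind_nonneg _ _)
    rw [avg_sub, avg_sub, avg_sub, avg_add, e1, e2, hEc] at e3
    linarith
  -- edges inside the subcube
  have hinside : (2 * k + 2) * β - 2 * (√n * ω) ≤
      avg Finset.univ (fun y => ind A y * ∑ i ∈ Iᶜ, ind B (flip y i)) z := by
    have e1 : avg Finset.univ (fun y => c y * (ind A y * ∑ i ∈ Iᶜ, ind B (flip y i))) z ≤
        avg Finset.univ (fun y => ind A y * ∑ i ∈ Iᶜ, ind B (flip y i)) z := by
      refine avg_mono _ (fun y => ?_) z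
      have : 0 ≤ ind A y * ∑ i ∈ Iᶜ, ind B (flip y i) :=
        mul_nonneg (ind_nonneg _ _) (Finset.sum_nonneg fun i _ => ind_nonneg _ _)
      nlinarith [hc1 y]
    rw [hc, avg_univ_ind_subcube_mul, hI] at e1
    -- Here `X = 1`, and the roles of `A` and `B` are exchanged: the small set is the part of the
    -- subcube missing from `A`.
    have e2 := profile_le_edgeDensity h.swap (le_refl (1 : ℝ)) Iᶜ z
    rw [edgeDensity_comm, Real.sqrt_one] at e2
    have e3 : (1 / 2 : ℝ) ^ k * avg Iᶜ (ind B) z = β := by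
      rw [hβ, hc, avg_univ_ind_subcube_mul, hI]
    have e4 : (1 / 2 : ℝ) ^ k * avg Iᶜ (ind W) z = γ := by
      rw [hγ, hc, avg_univ_ind_subcube_mul, hI]
    have e5 : 1 - avg Iᶜ (ind A) z = avg Iᶜ (ind B) z + avg Iᶜ (ind W) z := by
      linarith [h.avg_add Iᶜ z]
    rw [e5] at e2
    set b := avg Iᶜ (ind B) z with hb
    set w := avg Iᶜ (ind W) z with hw
    have hb0 : 0 ≤ b := avg_nonneg _ (ind_nonneg B) z
    have hw0 : 0 ≤ w := avg_nonneg _ (ind_nonneg W) z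
    have e6 : b + w ≤ (1 / 2) ^ ((k + 2) ^ 2) := by
      have hζ0 : 0 ≤ ζ := avg_nonneg _ (fun y =>
        mul_nonneg (by linarith [hc1 y]) (ind_nonneg A y)) z
      have : (1 / 2 : ℝ) ^ k * (b + w) ≤ (1 / 2) ^ k * (1 / 2) ^ ((k + 2) ^ 2) := by
        rw [mul_add, e3, e4]; linarith
      exact le_of_mul_le_mul_left this hPk0
    have e7 := profile_one_ge (by linarith) e6
    have e8 : (2 * k + 2) * b - 2 * (√n * w) ≤ edgeDensity Iᶜ A B z := by
      have : 0 ≤ ((k : ℝ) + 1) * w := by positivity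
      linarith
    have e9 := mul_le_mul_of_nonneg_left e8 hPk0.le
    have e10 : (1 / 2 : ℝ) ^ k * ((2 * k + 2) * b - 2 * (√n * w)) =
        (2 * k + 2) * β - 2 * (√n * γ) := by rw [← e3, ← e4]; ring
    rw [e10] at e9
    have e11 : √n * γ ≤ √n * ω := by gcongr
    change _ ≤ (1 / 2 : ℝ) ^ k * edgeDensity Iᶜ A B z at e9
    change (1 / 2 : ℝ) ^ k * edgeDensity Iᶜ A B z ≤ _ at e1
    linarith
  have hsplit : edgeDensity Finset.univ A B z =
      avg Finset.univ (fun y => ind A y * ∑ i ∈ Iᶜ, ind B (flip y i)) z +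
      ∑ i ∈ I, avg Finset.univ (fun y => ind A y * ind B (flip y i)) z := by
    rw [← avg_sum, ← avg_add]
    unfold edgeDensity
    congr 1
    funext y
    rw [← Finset.mul_sum, ← mul_add, Finset.sum_compl_add_sum]
  have hcs := Finset.sum_le_sum hcross
  rw [Finset.sum_const, hI, nsmul_eq_mul] at hcs
  have hk0 : (0 : ℝ) ≤ k := k.cast_nonneg
  have hkε : (k : ℝ) * (ε * (1 / 2) ^ k) ≤ k * ε := by
    gcongr
    nlinarith
  have hkζ : (k : ℝ) * ζ ≤ k * (ε * (1 / 2) ^ k + β + ω) := by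
    gcongr
    linarith
  have hkω : (k : ℝ) * ω ≤ k * (D * ε) := by gcongr
  have hεk : ε * (1 / 2) ^ k ≤ ε := by nlinarith
  rw [hsplit] at hE
  -- The inner edges contribute `(2k+2) β`. The `k` faces lose `k β` directly and another `k β`
  -- through `ζ`, leaving `2 β`.
  have h2β : 2 * β ≤ 2 * (D * ε) + 3 * (k * (D * ε)) + 2 * (k * ε) := by linarith
  rw [habs]
  linarith

/-! ### Cardinalities expressed as averages -/

theorem graph_adj_iff {x y : Cube n} : (graph n).Adj x y ↔ ∃ i, y = flip x i := by
  change hammingDist x y = 1 ↔ _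
  rw [hammingDist, Finset.card_eq_one]
  constructor
  · rintro ⟨i, hi⟩
    refine ⟨i, funext fun j => ?_⟩
    have hj : x j ≠ y j ↔ j = i := by
      rw [← Finset.mem_singleton, ← hi]; simp
    rw [flip_apply]
    by_cases h : j = i
    · have := hj.2 h
      rw [if_pos h]
      cases hx : x j <;> cases hy : y j <;> simp_all
    · rw [if_neg h]
      by_contra hc
      exact h (hj.1 (Ne.symm hc))
  · rintro ⟨i, rfl⟩
    refine ⟨i, ?_⟩
    ext j
    simp only [Finset.mem_filter, Finset.mem_univ, true_and, Finset.mem_singleton, flip_apply]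
    by_cases h : j = i <;> simp [h]

theorem flip_injective (x : Cube n) : Function.Injective (flip x) := by
  intro i j h
  by_contra hij
  have := congrFun h i
  rw [flip_apply, flip_apply, if_pos rfl, if_neg hij] at this
  simp at this

theorem deg_eq_sum (T : Finset (Cube n)) (x : Cube n) :
    (deg T x : ℝ) = ∑ i, ind T (flip x i) := by
  have : (T.filter fun y => (graph n).Adj x y) =
      (Finset.univ.filter fun i => flip x i ∈ T).image (flip x) := by
    ext y
    simp only [Finset.mem_filter, Finset.mem_image, Finset.mem_univ, true_and, graph_adj_iff]
    constructor
    · rintro ⟨hy, i, rfl⟩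
      exact ⟨i, hy, rfl⟩
    · rintro ⟨i, hi, rfl⟩
      exact ⟨hi, i, rfl⟩
  rw [deg, this, Finset.card_image_of_injective _ (flip_injective x), Finset.card_filter]
  push_cast
  rfl

theorem deg_le (T : Finset (Cube n)) (x : Cube n) : deg T x ≤ n := by
  have : (deg T x : ℝ) ≤ n := by
    rw [deg_eq_sum]
    calc ∑ i, ind T (flip x i) ≤ ∑ _i : Fin n, (1 : ℝ) := Finset.sum_le_sum fun i _ => ind_le_one _ _
      _ = n := by simp
  exact_mod_cast this

theorem card_nabla (A B : Finset (Cube n)) (x : Cube n) :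
    ((nabla A B).card : ℝ) / 2 ^ n = edgeDensity Finset.univ A B x := by
  rw [edgeDensity, avg_univ]
  congr 1
  rw [nabla, Finset.card_filter, Finset.sum_product]
  push_cast
  have : ∀ y, ind A y * ∑ i, ind B (flip y i) = if y ∈ A then (deg B y : ℝ) else 0 := by
    intro y
    rw [← deg_eq_sum, ind]
    split_ifs <;> simp
  simp only [this, Finset.sum_ite_mem, Finset.univ_inter]
  refine Finset.sum_congr rfl fun y _ => ?_
  rw [deg, Finset.card_filter]
  push_cast
  rfl

theorem card_nablaDir (i : Fin n) (A : Finset (Cube n)) (x : Cube n) :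
    ((nablaDir i A).card : ℝ) / 2 ^ n =
      avg Finset.univ (fun y => ind A y * (1 - ind A (flip y i))) x := by
  rw [avg_univ]
  congr 1
  rw [nablaDir, Finset.card_filter, Finset.sum_product]
  push_cast
  have : ∀ y, ind A y * (1 - ind A (flip y i)) =
      if y ∈ A then (1 - ind A (flip y i)) else 0 := by
    intro y
    rw [ind]
    split_ifs <;> simp
  simp only [this, Finset.sum_ite_mem, Finset.univ_inter]
  refine Finset.sum_congr rfl fun y _ => ?_
  rw [Finset.sum_ite_eq']
  simp only [Finset.mem_compl, ind]
  split_ifs <;> simp_all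

theorem mu_symmDiff (C A : Finset (Cube n)) (x : Cube n) :
    mu (symmDiff C A) = avg Finset.univ (fun y => |ind A y - ind C y|) x := by
  rw [mu_eq_avg _ x]
  congr 1
  funext y
  simp only [ind, Finset.mem_symmDiff]
  by_cases h1 : y ∈ A <;> by_cases h2 : y ∈ C <;> simp [h1, h2]

/-- The size of the directional boundary is continuous in the set. -/
theorem abs_avg_boundary_sub_le {A : Finset (Cube n)} {I : Finset (Fin n)} {i : Fin n}
    (hi : i ∈ I) (z : Cube n) :
    |avg Finset.univ (fun y => ind A y * (1 - ind A (flip y i))) z - (1 / 2) ^ I.card| ≤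
      2 * avg Finset.univ (fun y => |ind A y - ind (subcube I z) y|) z := by
  set c := ind (subcube I z) with hc
  have e1 : avg Finset.univ (fun y => |ind A (flip y i) - c (flip y i)|) z =
      avg Finset.univ (fun y => |ind A y - c y|) z :=
    avg_comp_flip_mem (Finset.mem_univ i) (fun y => |ind A y - c y|) z
  have hcc : ∀ y, c y * c (flip y i) = 0 := by
    intro y
    have h := ind_subcube_add_flip_le hi z y
    rcases ind_eq_zero_or_one (subcube I z) y with h1 | h1
    · rw [hc, h1, zero_mul]
    · have h2 := ind_nonneg (subcube I z) (flip y i)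
      have : ind (subcube I z) (flip y i) = 0 := by linarith
      rw [hc, this, mul_zero]
  have hpt : ∀ y, |ind A y * (1 - ind A (flip y i)) - c y| ≤
      |ind A y - c y| + |ind A (flip y i) - c (flip y i)| := by
    intro y
    -- The identity uses that a subcube contains no edge in a fixed direction `i ∈ I`, that is,
    -- `hcc`.
    have e : ind A y * (1 - ind A (flip y i)) - c y =
        (ind A y - c y) * (1 - ind A (flip y i)) + c y * (c (flip y i) - ind A (flip y i)) := by
      linear_combination (-1 : ℝ) * hcc y
    rw [e]
    refine (abs_add_le _ _).trans (add_le_add ?_ ?_)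
    · rw [abs_mul]
      refine mul_le_of_le_one_right (abs_nonneg _) ?_
      rw [abs_le]
      constructor <;> linarith [ind_nonneg A (flip y i), ind_le_one A (flip y i)]
    · rw [abs_mul, abs_sub_comm (c (flip y i))]
      refine mul_le_of_le_one_left (abs_nonneg _) ?_
      rw [abs_le]
      constructor <;> linarith [ind_nonneg (subcube I z) y, ind_le_one (subcube I z) y]
  rw [← avg_univ_ind_subcube I z z, ← avg_sub, two_mul]
  nth_rewrite 2 [← e1]
  rw [← avg_add, abs_le]
  constructor
  · have := avg_mono Finset.univ (fun y => (abs_le.1 (hpt y)).1) z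
    have e2 : avg Finset.univ (fun y => -(|ind A y - c y| + |ind A (flip y i) - c (flip y i)|)) z =
        -avg Finset.univ (fun y => |ind A y - c y| + |ind A (flip y i) - c (flip y i)|) z := by
      have := avg_const_mul Finset.univ (-1)
        (fun y => |ind A y - c y| + |ind A (flip y i) - c (flip y i)|) z
      simpa using this
    rw [← e2]
    exact this
  · exact avg_mono Finset.univ (fun y => (abs_le.1 (hpt y)).2) z

/-! ### Hamming balls and the growth of `f` -/

theorem centralBinom_sq_le (m : ℕ) : (2 * m + 1) * Nat.centralBinom m ^ 2 ≤ 16 ^ m := by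
  induction m with
  | zero => simp
  | succ m ih =>
    have h := Nat.succ_mul_centralBinom_succ m
    have h4 : (2 * m + 3) * (2 * m + 1) ≤ 4 * (m + 1) ^ 2 := by nlinarith
    have h2 : (m + 1) ^ 2 * ((2 * (m + 1) + 1) * Nat.centralBinom (m + 1) ^ 2) ≤
        (m + 1) ^ 2 * 16 ^ (m + 1) := by
      calc (m + 1) ^ 2 * ((2 * (m + 1) + 1) * Nat.centralBinom (m + 1) ^ 2)
          = (2 * m + 3) * ((m + 1) * Nat.centralBinom (m + 1)) ^ 2 := by ring
        _ = 4 * ((2 * m + 3) * (2 * m + 1)) * ((2 * m + 1) * Nat.centralBinom m ^ 2) := by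
          rw [h]; ring
        _ ≤ 4 * (4 * (m + 1) ^ 2) * 16 ^ m := Nat.mul_le_mul (Nat.mul_le_mul_left 4 h4) ih
        _ = (m + 1) ^ 2 * 16 ^ (m + 1) := by ring
    exact Nat.le_of_mul_le_mul_left h2 (by positivity)

theorem mul_choose_half_sq_le (n : ℕ) : n * n.choose (n / 2) ^ 2 ≤ 4 ^ n := by
  rcases Nat.even_or_odd' n with ⟨m, rfl | rfl⟩
  · have h := centralBinom_sq_le m
    rw [Nat.centralBinom_eq_two_mul_choose] at h
    rw [Nat.mul_div_cancel_left m (by norm_num), pow_mul]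
    norm_num
    nlinarith
  · have h := centralBinom_sq_le m
    have e : (2 * m + 1) / 2 = m := by omega
    have hc : (2 * m + 1).choose m ≤ 2 * Nat.centralBinom m := by
      rcases m with _ | m
      · simp
      · rw [Nat.choose_succ_succ']
        have h1 := Nat.choose_le_centralBinom m (m + 1)
        have h2 := Nat.choose_le_centralBinom (m + 1) (m + 1)
        omega
    rw [e]
    calc (2 * m + 1) * (2 * m + 1).choose m ^ 2
        ≤ (2 * m + 1) * (2 * Nat.centralBinom m) ^ 2 := by gcongr
      _ = 4 * ((2 * m + 1) * Nat.centralBinom m ^ 2) := by ring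
      _ ≤ 4 * 16 ^ m := by gcongr
      _ = 4 ^ (2 * m + 1) := by rw [pow_succ, pow_mul]; norm_num; ring

/-- The number of coordinates of `x` equal to `true`. -/
def weight (x : Cube n) : ℕ := (Finset.univ.filter fun i => x i = true).card

theorem weight_le (x : Cube n) : weight x ≤ n :=
  (Finset.card_le_univ _).trans_eq (by simp)

theorem weight_flip_le (x : Cube n) (i : Fin n) : weight (flip x i) ≤ weight x + 1 := by
  unfold weight
  refine (Finset.card_le_card (t := insert i (Finset.univ.filter fun j => x j = true)) ?_).trans
    (Finset.card_insert_le _ _)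
  intro j
  simp only [Finset.mem_filter, Finset.mem_univ, true_and, Finset.mem_insert, flip_apply]
  by_cases h : j = i <;> simp [h]

/-- The set of vertices of weight `r`. -/
def layer (n r : ℕ) : Finset (Cube n) := Finset.univ.filter fun x => weight x = r

/-- The Hamming ball of vertices of weight less than `r`. -/
def ball (n r : ℕ) : Finset (Cube n) := Finset.univ.filter fun x => weight x < r

theorem card_layer_le (n r : ℕ) : (layer n r).card ≤ n.choose (n / 2) := by
  have : (layer n r).card ≤ (Finset.powersetCard r (Finset.univ : Finset (Fin n))).card := by
    refine Finset.card_le_card_of_injOn (fun x => Finset.univ.filter fun i => x i = true) ?_ ?_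
    · intro x hx
      have : weight x = r := by simpa [layer] using hx
      simpa [Finset.mem_powersetCard, weight] using this
    · intro x _ y _ h
      funext i
      have := Finset.ext_iff.1 h i
      simp only [Finset.mem_filter, Finset.mem_univ, true_and] at this
      exact Bool.eq_iff_iff.2 this
  rw [Finset.card_powersetCard, Finset.card_univ, Fintype.card_fin] at this
  exact this.trans (Nat.choose_le_middle r n)

theorem sqrt_mul_mu_layer_le (n r : ℕ) : √n * mu (layer n r) ≤ 1 := by
  have h1 : (n : ℝ) * (n.choose (n / 2) : ℝ) ^ 2 ≤ 4 ^ n := by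
    exact_mod_cast mul_choose_half_sq_le n
  have h2 : ((layer n r).card : ℝ) ≤ n.choose (n / 2) := by exact_mod_cast card_layer_le n r
  rw [mu, mul_div_assoc', div_le_one (by positivity)]
  refine (abs_le_of_sq_le_sq' ?_ (by positivity)).2
  rw [mul_pow, Real.sq_sqrt (by positivity), ← pow_mul, mul_comm n 2, pow_mul]
  calc (n : ℝ) * ((layer n r).card : ℝ) ^ 2 ≤ n * (n.choose (n / 2) : ℝ) ^ 2 := by gcongr
    _ ≤ _ := by norm_num; exact h1

theorem mu_ball_succ (n r : ℕ) : mu (ball n (r + 1)) = mu (ball n r) + mu (layer n r) := by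
  have hd : Disjoint (ball n r) (layer n r) := by
    rw [Finset.disjoint_left]
    intro x hx hx'
    simp only [ball, layer, Finset.mem_filter, Finset.mem_univ, true_and] at hx hx'
    omega
  have hu : ball n (r + 1) = ball n r ∪ layer n r := by
    ext x
    simp only [ball, layer, Finset.mem_filter, Finset.mem_univ, true_and, Finset.mem_union]
    omega
  rw [hu, mu, mu, mu, Finset.card_union_of_disjoint hd]
  push_cast
  ring

theorem h_ball_eq_zero {r : ℕ} {x : Cube n} (hx : weight x ≠ r) : h (ball n (r + 1)) x = 0 := by
  unfold h
  split_ifs with hmem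
  · have hlt : weight x < r := by
      have : weight x < r + 1 := by simpa [ball] using hmem
      omega
    have : (deg (ball n (r + 1))ᶜ x : ℝ) = 0 := by
      rw [deg_eq_sum]
      refine Finset.sum_eq_zero fun i _ => ?_
      have : flip x i ∈ ball n (r + 1) := by
        have := weight_flip_le x i
        simp only [ball, Finset.mem_filter, Finset.mem_univ, true_and]
        omega
      simp [ind, this]
    exact_mod_cast this
  · rfl

theorem h_le (S : Finset (Cube n)) (x : Cube n) : h S x ≤ n := by
  unfold h
  split_ifs
  · exact deg_le _ _
  · exact Nat.zero_le _

/-- Only the outermost layer of a ball has neighbours outside it, and each of its vertices has at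
most `n` of them. -/
theorem integral_ball_le {f : ℝ → ℝ} (hf_mono : MonotoneOn f (Set.Ici 0)) (hf_zero : f 0 = 0)
    (n r : ℕ) : integral (fun x => f (h (ball n (r + 1)) x)) ≤ f n * mu (layer n r) := by
  have hmu : ∀ x : Cube n, mu {x} = 1 / 2 ^ n := fun x => by simp [mu]
  unfold integral
  simp only [hmu]
  rw [← Finset.sum_mul, mu, div_eq_mul_one_div ((layer n r).card : ℝ), ← mul_assoc]
  gcongr
  calc ∑ x : Cube n, f (h (ball n (r + 1)) x)
      ≤ ∑ x : Cube n, if x ∈ layer n r then f n else 0 := by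
        refine Finset.sum_le_sum fun x _ => ?_
        split_ifs with hx
        · exact hf_mono (Set.mem_Ici.2 (Nat.cast_nonneg _)) (Set.mem_Ici.2 (Nat.cast_nonneg _))
            (by exact_mod_cast h_le _ x)
        · have : weight x ≠ r := by simpa [layer] using hx
          rw [h_ball_eq_zero this, Nat.cast_zero, hf_zero]
    _ = f n * (layer n r).card := by
        rw [Finset.sum_ite_mem, Finset.univ_inter, Finset.sum_const, nsmul_eq_mul]
        ring

/-- Take the first radius at which the measure reaches `a`; the overshoot is at most the last layer.
-/
theorem exists_ball (n : ℕ) {a : ℝ} (ha0 : 0 < a) (ha1 : a ≤ 1) :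
    ∃ r, a ≤ mu (ball n (r + 1)) ∧ mu (ball n (r + 1)) ≤ a + mu (layer n r) := by
  classical
  have hex : ∃ r, a ≤ mu (ball n r) := by
    refine ⟨n + 1, ?_⟩
    have : ball n (n + 1) = Finset.univ := by
      ext x
      have := weight_le x
      simp only [ball, Finset.mem_filter, Finset.mem_univ, true_and, iff_true]
      omega
    rw [this, mu]
    simpa using ha1
  have hs := Nat.find_spec hex
  rcases hr : Nat.find hex with _ | r
  · rw [hr] at hs
    have : ball n 0 = ∅ := by simp [ball]
    rw [this] at hs
    simp [mu] at hs
    linarith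
  · rw [hr] at hs
    refine ⟨r, hs, ?_⟩
    have := Nat.find_min hex (m := r) (by omega)
    rw [mu_ball_succ]
    linarith

theorem mu_nonneg (S : Finset (Cube n)) : 0 ≤ mu S := by unfold mu; positivity

theorem mu_le_one (S : Finset (Cube n)) : mu S ≤ 1 := by
  have x : Cube n := fun _ => false
  rw [mu_eq_avg S x]
  exact avg_le_one _ (ind_le_one S) x

/-- An isoperimetric inequality for `∫ f(h_A)`, tested on Hamming balls, forces `f(n)` to be at
least of order `√n`. -/
theorem exists_sqrt_le_of_isoperimetric {k : ℕ} (hk : 1 ≤ k) {f g : ℝ → ℝ}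
    (hg_cont : ContinuousOn g (Set.Icc 0 1))
    (hg_val : g ((1 / 2 : ℝ) ^ k) = k * (1 / 2 : ℝ) ^ k)
    (hf_mono : MonotoneOn f (Set.Ici 0)) (hf_zero : f 0 = 0) (hf_val : f k = k) :
    ∃ c : ℝ, 0 < c ∧ ∀ n : ℕ, k ≤ n →
      (∀ A : Finset (Cube n), g (mu A) ≤ integral fun x => f (h A x)) →
      c * √((n : ℝ) + 1) ≤ f n := by
  set P : ℝ := (1 / 2) ^ k with hP
  have hP0 : 0 < P := by positivity
  have hP1 : P ≤ 1 := pow_le_one₀ (by norm_num) (by norm_num)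
  have hk1 : (1 : ℝ) ≤ k := by exact_mod_cast hk
  obtain ⟨τ, hτ0, hτ⟩ := Metric.continuousOn_iff.1 hg_cont P ⟨hP0.le, hP1⟩ (P / 2) (by linarith)
  -- Since `g P = k P ≥ P`, continuity keeps `g` above `P / 2` near `P`.
  have hlow : ∀ a ∈ Set.Icc (0 : ℝ) 1, |a - P| < τ → P / 2 ≤ g a := by
    intro a ha hap
    have := hτ a ha (by rwa [Real.dist_eq])
    rw [Real.dist_eq, hg_val] at this
    have := (abs_lt.1 this).1
    nlinarith
  obtain ⟨M, hM⟩ := exists_nat_gt (1 / τ ^ 2)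
  refine ⟨min (P / 4) (1 / √((M : ℝ) + 1)), lt_min (by linarith) (by positivity),
    fun n hkn hiso => ?_⟩
  have hn1 : (1 : ℝ) ≤ n := by exact_mod_cast hk.trans hkn
  have hs0 : 0 ≤ √((n : ℝ) + 1) := Real.sqrt_nonneg _
  -- For bounded `n` the bound `f n ≥ f k = k ≥ 1` suffices. For larger `n` a layer has measure at
  -- most `1/√n < τ`, so some ball has measure within `τ` of `P`.
  rcases le_total n M with hnM | hnM
  · calc min (P / 4) (1 / √((M : ℝ) + 1)) * √((n : ℝ) + 1)
        ≤ 1 / √((M : ℝ) + 1) * √((M : ℝ) + 1) := by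
          gcongr
          exact min_le_right _ _
      _ = 1 := by field_simp
      _ ≤ k := hk1
      _ = f k := hf_val.symm
      _ ≤ f n := hf_mono (Set.mem_Ici.2 (by positivity)) (Set.mem_Ici.2 (by positivity))
          (by exact_mod_cast hkn)
  · obtain ⟨r, hr1, hr2⟩ := exists_ball n hP0 hP1
    have hL := sqrt_mul_mu_layer_le n r
    have hsn : 0 < √(n : ℝ) := Real.sqrt_pos.2 (by linarith)
    have hτn : 1 < τ * √n := by
      have h1 : 1 / τ ^ 2 < n := hM.trans_le (by exact_mod_cast hnM)
      rw [div_lt_iff₀ (by positivity)] at h1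
      have h2 : (τ * √n) ^ 2 = n * τ ^ 2 := by
        rw [mul_pow, Real.sq_sqrt (by linarith)]; ring
      by_contra hc
      push Not at hc
      have h3 : (τ * √n) ^ 2 ≤ 1 := pow_le_one₀ (by positivity) hc
      linarith
    have hLτ : mu (layer n r) < τ := by
      by_contra hc
      push Not at hc
      have : τ * √n ≤ mu (layer n r) * √n := by gcongr
      linarith
    have hg1 := hlow _ ⟨mu_nonneg _, mu_le_one (ball n (r + 1))⟩
      (abs_lt.2 ⟨by linarith, by linarith⟩)
    have hint := (hg1.trans (hiso _)).trans (integral_ball_le hf_mono hf_zero n r)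
    have hfn : 0 ≤ f n := by
      rw [← hf_zero]
      exact hf_mono (Set.mem_Ici.2 le_rfl) (Set.mem_Ici.2 (by positivity)) (by positivity)
    have h1 : P / 2 * √n ≤ f n := by
      calc P / 2 * √n ≤ f n * mu (layer n r) * √n := by gcongr
        _ = f n * (√n * mu (layer n r)) := by ring
        _ ≤ f n * 1 := by gcongr
        _ = f n := mul_one _
    have h2 : √((n : ℝ) + 1) ≤ 2 * √n := by
      refine Real.sqrt_le_iff.2 ⟨by positivity, ?_⟩
      rw [mul_pow, Real.sq_sqrt (by linarith)]
      linarith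
    calc min (P / 4) (1 / √((M : ℝ) + 1)) * √((n : ℝ) + 1) ≤ P / 4 * (2 * √n) := by
          gcongr
          exact min_le_left _ _
      _ = P / 2 * √n := by ring
      _ ≤ f n := h1

end Cube

/-! ### Assembly of the theorem -/

theorem theorem1p10 (k : ℕ) (hk : 1 ≤ k) (f g : ℝ → ℝ)
    (hf_nonneg : ∀ t ∈ Set.Ici (0 : ℝ), 0 ≤ f t)
    (hg_nonneg : ∀ t ∈ Set.Icc (0 : ℝ) 1, 0 ≤ g t)
    (hg_cont : ContinuousOn g (Set.Icc 0 1))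
    (hg_val : g ((1 / 2 : ℝ) ^ k) = k * (1 / 2 : ℝ) ^ k)
    (hf_mono : MonotoneOn f (Set.Ici 0))
    (hf_conc : StrictConcaveOn ℝ (Set.Ici 0) f)
    (hf_zero : f 0 = 0) (hf_val : f k = k) :
    ∃ K : ℝ, 0 < K ∧ ∀ n : ℕ, k ≤ n →
      (∀ A : Finset (Cube n), g (Cube.mu A) ≤ Cube.integral fun x => f (Cube.h A x)) →
      ∀ ε : ℝ, 0 < ε → ∀ A B W : Finset (Cube n), Cube.IsPartition A B W →
        |Cube.mu A - (1 / 2 : ℝ) ^ k| ≤ ε * (1 / 2 : ℝ) ^ k →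
        Cube.mu W ≤ ε / f n →
        ((Cube.nabla A B).card : ℝ) < (1 + ε) * (k * 2 ^ (n - k)) →
        (∃ I : Finset (Fin n), I.card = k ∧ ∀ i ∈ I,
          |((Cube.nablaDir i A).card : ℝ) - 2 ^ (n - k)| ≤ K * ε * 2 ^ (n - k)) ∧
        (∃ C : Finset (Cube n), Cube.IsSubcube k C ∧ Cube.mu (symmDiff C A) ≤ K * ε) := by
  obtain ⟨c, hc0, hc⟩ := Cube.exists_sqrt_le_of_isoperimetric hk hg_cont hg_val hf_mono hf_zero hf_val
  obtain ⟨η, hη0, hη⟩ := Cube.exists_subcube_close k ((1 / 2) ^ k * (1 / 2) ^ ((k + 2) ^ 2))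
    (by positivity)
  set D : ℝ := 1 / c with hD
  have hD0 : 0 < D := by positivity
  set K₀ : ℝ := 2 * k + (3 * k + 4) * D + 1 with hK₀
  have hK₀0 : 0 < K₀ := by positivity
  set ε₀ : ℝ := η / (k + D + 1) with hε₀
  have hε₀0 : 0 < ε₀ := by positivity
  -- The factor `2 ^ k` converts `2 ^ n` into `2 ^ (n - k)`, the `2` in `2 * K₀` comes from
  -- `abs_avg_boundary_sub_le`, and `1 / ε₀` makes the case `ε ≥ ε₀` trivial.
  refine ⟨2 ^ k * (2 * K₀ + 1 / ε₀), by positivity, ?_⟩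
  intro n hkn hiso ε hε A B W hpart hA hW hE
  have hpow1 : (1 : ℝ) ≤ 2 ^ k := one_le_pow₀ (by norm_num)
  have hpown : (2 : ℝ) ^ n = 2 ^ k * 2 ^ (n - k) := by
    rw [← pow_add, Nat.add_sub_cancel' hkn]
  have hhalf : (1 / 2 : ℝ) ^ k * 2 ^ k = 1 := by rw [← mul_pow]; norm_num
  have hdir : ∀ (i : Fin n) (x : Cube n) (t : ℝ),
      |Cube.avg Finset.univ (fun y => Cube.ind A y * (1 - Cube.ind A (Cube.flip y i))) x
        - (1 / 2) ^ k| ≤ t →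
      |((Cube.nablaDir i A).card : ℝ) - 2 ^ (n - k)| ≤ t * 2 ^ n := by
    intro i x t ht
    rw [← Cube.card_nablaDir] at ht
    have e : ((Cube.nablaDir i A).card : ℝ) - 2 ^ (n - k) =
        (((Cube.nablaDir i A).card : ℝ) / 2 ^ n - (1 / 2) ^ k) * 2 ^ n := by
      rw [sub_mul, div_mul_cancel₀ _ (by positivity), hpown, ← mul_assoc, hhalf, one_mul]
    rw [e, abs_mul, abs_of_pos (by positivity : (0 : ℝ) < 2 ^ n)]
    gcongr
  rcases le_total ε₀ ε with hbig | hsmall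
  · have h1 : 1 ≤ 1 / ε₀ * ε := by
      rw [one_div_mul_eq_div, one_le_div hε₀0]; exact hbig
    have hK1 : 1 ≤ (2 * K₀ + 1 / ε₀) * ε := by
      have : 0 ≤ 2 * K₀ * ε := by positivity
      linarith
    have x : Cube n := fun _ => false
    obtain ⟨I, -, hI⟩ := Finset.exists_subset_card_eq
      (s := (Finset.univ : Finset (Fin n))) (n := k) (by simpa using hkn)
    refine ⟨⟨I, hI, fun i _ => ?_⟩, Cube.subcube I x, ⟨I, hI, x, rfl⟩, ?_⟩
    · have hb0 : ∀ y, 0 ≤ Cube.ind A y * (1 - Cube.ind A (Cube.flip y i)) := fun y =>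
        mul_nonneg (Cube.ind_nonneg _ _) (by linarith [Cube.ind_le_one A (Cube.flip y i)])
      have hb1 : ∀ y, Cube.ind A y * (1 - Cube.ind A (Cube.flip y i)) ≤ 1 := fun y =>
        mul_le_one₀ (Cube.ind_le_one _ _) (by linarith [Cube.ind_le_one A (Cube.flip y i)])
          (by linarith [Cube.ind_nonneg A (Cube.flip y i)])
      have a0 := Cube.avg_nonneg Finset.univ hb0 x
      have a1 := Cube.avg_le_one Finset.univ hb1 x
      have hP0 : (0 : ℝ) < (1 / 2) ^ k := by positivity
      have hP1 : (1 / 2 : ℝ) ^ k ≤ 1 := pow_le_one₀ (by norm_num) (by norm_num)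
      refine (hdir i x 1 (abs_le.2 ⟨by linarith, by linarith⟩)).trans ?_
      rw [hpown]
      calc 1 * (2 ^ k * 2 ^ (n - k) : ℝ) ≤ ((2 * K₀ + 1 / ε₀) * ε) * (2 ^ k * 2 ^ (n - k)) := by
            gcongr
        _ = _ := by ring
    · refine (Cube.mu_le_one _).trans ?_
      calc (1 : ℝ) ≤ 1 * ((2 * K₀ + 1 / ε₀) * ε) := by linarith
        _ ≤ 2 ^ k * ((2 * K₀ + 1 / ε₀) * ε) := by gcongr
        _ = _ := by ring
  · have hεη : (k + D + 1) * ε ≤ η := by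
      rw [hε₀, le_div_iff₀ (by positivity)] at hsmall
      linarith
    have hP0 : (0 : ℝ) < (1 / 2) ^ k := by positivity
    have hP1 : (1 / 2 : ℝ) ^ k ≤ 1 := pow_le_one₀ (by norm_num) (by norm_num)
    have hk0 : (0 : ℝ) ≤ k := k.cast_nonneg
    have hkε : 0 ≤ (k : ℝ) * ε := by positivity
    have hDε : 0 ≤ D * ε := by positivity
    have hf := hc n hkn hiso
    have hs0 : 0 < √((n : ℝ) + 1) := Real.sqrt_pos.2 (by positivity)
    have hfn : 0 < f n := lt_of_lt_of_le (by positivity) hf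
    have hWD : √((n : ℝ) + 1) * Cube.mu W ≤ D * ε := by
      calc √((n : ℝ) + 1) * Cube.mu W ≤ √((n : ℝ) + 1) * (ε / f n) := by gcongr
        _ ≤ √((n : ℝ) + 1) * (ε / (c * √((n : ℝ) + 1))) := by gcongr
        _ = D * ε := by rw [hD]; field_simp
    have hEd : ∀ x, Cube.edgeDensity Finset.univ A B x ≤ (1 + ε) * (k * (1 / 2 : ℝ) ^ k) := by
      intro x
      rw [← Cube.card_nabla, div_le_iff₀ (by positivity)]
      refine hE.le.trans (le_of_eq ?_)
      rw [hpown]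
      linear_combination (-(1 + ε) * k * 2 ^ (n - k)) * hhalf
    have x : Cube n := fun _ => false
    rw [Cube.mu_eq_avg A x] at hA
    rw [Cube.mu_eq_avg W x] at hWD
    obtain ⟨I, -, hI, z, hz⟩ := hη n Finset.univ x A B W hpart
      (hA.trans (by nlinarith)) ((hEd x).trans (by nlinarith)) (hWD.trans (by nlinarith))
    -- Averages over the whole cube do not depend on the base point, which is moved into the subcube
    -- found.
    have hbase : ∀ φ : Cube n → ℝ, Cube.avg Finset.univ φ x = Cube.avg Finset.univ φ z := fun φ => by
      rw [Cube.avg_univ, Cube.avg_univ]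
    rw [hbase] at hA hWD hz
    have hlin := Cube.avg_abs_sub_subcube_le hpart hI z hε.le (abs_le.1 hA).2 hWD (hEd z) hz
    rw [← hK₀] at hlin
    have hε' : 0 ≤ 1 / ε₀ * ε := by positivity
    refine ⟨⟨I, hI, fun i hi => ?_⟩, Cube.subcube I z, ⟨I, hI, z, rfl⟩, ?_⟩
    · have hb := Cube.abs_avg_boundary_sub_le (A := A) hi z
      rw [hI] at hb
      refine (hdir i z _ (hb.trans (mul_le_mul_of_nonneg_left hlin zero_le_two))).trans ?_
      rw [hpown]
      calc 2 * (K₀ * ε) * (2 ^ k * 2 ^ (n - k) : ℝ)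
          ≤ (2 * (K₀ * ε) + 1 / ε₀ * ε) * (2 ^ k * 2 ^ (n - k)) := by gcongr; linarith
        _ = _ := by ring
    · rw [Cube.mu_symmDiff _ _ z]
      have : 0 ≤ K₀ * ε := by positivity
      calc _ ≤ K₀ * ε := hlin
        _ ≤ 1 * (2 * (K₀ * ε) + 1 / ε₀ * ε) := by linarith
        _ ≤ 2 ^ k * (2 * (K₀ * ε) + 1 / ε₀ * ε) := by gcongr
        _ = _ := by ring
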